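/- Let $n\ge 1$. Let $U_n^{\mathrm{nc}}$ be the universal unital complex $*$-algebra generated by $n^2$ elements $(u_{ij})_{1\le i,j\le n}$ with the relations $\sum_k u_{ki}^*u_{kj}=\delta_{ij}=\sum_k u_{ik}u_{jk}^*$. Let $\delta:U_n^{\mathrm{nc}}\to\mathbb C$ be the unital $*$-homomorphism with $\delta(u_{ij})=\delta_{ij}$, and let $\Delta:U_n^{\mathrm{nc}}\to U_n^{\mathrm{nc}}\sqcup U_n^{\mathrm{nc}}$ be the unital $*$-homomorphism with $\Delta(u_{ij})=\sum_k u_{ik}^{(1)}u_{kj}^{(2)}$, where $\sqcup$ is the free product of unital $*$-algebras (with identified units) and the exponents $(1),(2)$ denote its left and right leg. These data form the unitary dual group $U\langle n\rangle$. A state on a unital $*$-algebra $\mathcal A$ is a linear functional $\phi$ with $\phi(1)=1$ and $\phi(a^*a)\ge 0$ for all $a\in\mathcal A$. For states $\phi_1,\phi_2$ on $U_n^{\mathrm{nc}}$ there are five unital linear functionals on $U_n^{\mathrm{nc}}\sqcup U_n^{\mathrm{nc}}$, each determined by its values on products $A_1\cdots A_m$ ($m\ge1$) of elements $A_i$ of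 the leg $\epsilon_i\in\{1,2\}$ with $\epsilon_1\ne\epsilon_2\ne\cdots\ne\epsilon_m$: - the free product $\phi_1*\phi_2$: the value is $0$ whenever $\phi_{\epsilon_i}(A_i)=0$ for all $i$; and, whenever $\delta(A_i)=0$ for all $i$, - the tensor product: $\phi_1\big(\prod_{i:\epsilon_i=1}A_i\big)\,\phi_2\big(\prod_{i:\epsilon_i=2}A_i\big)$; - the boolean product: $\prod_{i=1}^m\phi_{\epsilon_i}(A_i)$; - the monotone product: $\phi_1\big(\prod_{i:\epsilon_i=1}A_i\big)\prod_{i:\epsilon_i=2}\phi_2(A_i)$; - the anti-monotone product: $\prod_{i:\epsilon_i=1}\phi_1(A_i)\;\phi_2\big(\prod_{i:\epsilon_i=2}A_i\big)$. Here the products inside $\phi_1$ and $\phi_2$ are taken in the order of the indices. The corresponding convolution of $\phi_1$ and $\phi_2$, denoted $\phi_1\star\phi_2$, is the composition of the product functional with $\Delta$. A Haar state on $U\langle n\rangle$ for one of the five convolutions $\star$ is a state $h$ on $U_n^{\mathrm{nc}}$ such that $\phi\star h=h=h\star\phi$ for all states $\phi$ on $U_n^{\mathrm{nc}}$. **Theorem.**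 1. For each of the five convolutions (free, tensor, boolean, monotone, anti-monotone), the normalized Haar measure $\mu$ on $\{z\in\mathbb C:|z|=1\}$, that is, the state on $U_1^{\mathrm{nc}}$ that maps a polynomial $p(u,u^*)$ in the generator $u=u_{11}$ and its adjoint to $\int p(z,\bar z)\,d\mu(z)$, is a Haar state on $U\langle 1\rangle$, and it is the only one. 2. For every $n\ge 2$ there is no Haar state on $U\langle n\rangle$ for any of the five convolutions. -/

import Mathlib

open scoped ComplexOrder TensorProduct

/-! ## Noncommutative probability: states, free products, the five products of states -/

namespace NCProb

/-- A state on a unital `*`-algebra: a unital positive linear functional. -/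
structure State (A : Type*) [Ring A] [StarRing A] [Algebra ℂ A] where
  /-- The underlying linear functional. -/
  toLin : A →ₗ[ℂ] ℂ
  map_one' : toLin 1 = 1
  nonneg' : ∀ a : A, 0 ≤ toLin (star a * a)

/-- The five notions of independence. -/
inductive Independence
  | free
  | tensor
  | boolean
  | monotone
  | antimonotone

section Products

variable {A : Type*} [Ring A] [Algebra ℂ A]

variable (A) in
/-- The free product `A ⊔ A` of a unital algebra with itself (units identified). The index `0` is
the left leg and the index `1` is the right leg. For a `*`-algebra `A` this is the underlying algebra
of the free product of `*`-algebras; the products of states do not involve its involution. -/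
abbrev FreeSq : Type _ := LinearAlgebra.FreeProduct ℂ (fun _ : Fin 2 => A)

/-- The embedding of `A` in `A ⊔ A` as the leg `i`. -/
noncomputable def leg (i : Fin 2) : A →ₐ[ℂ] FreeSq A :=
  LinearAlgebra.FreeProduct.ι ℂ (fun _ : Fin 2 => A) i

/-- The element `A₁ ⋯ Aₘ` of `A ⊔ A` given by a list of pairs `(εᵢ, Aᵢ)`, where `Aᵢ` is taken in
the leg `εᵢ`. -/
noncomputable def wordProd (w : List (Fin 2 × A)) : FreeSq A :=
  (w.map fun p => leg p.1 p.2).prod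

/-- Neighbouring letters lie in different legs. -/
def Alternating (w : List (Fin 2 × A)) : Prop :=
  w.IsChain fun p q => p.1 ≠ q.1

/-- The letters of `w` that lie in the leg `i`, in the order of `w`. -/
def legLetters (i : Fin 2) (w : List (Fin 2 × A)) : List A :=
  (w.filter fun p => p.1 = i).map Prod.snd

/-- `Φ` is the product of `φ 0` and `φ 1` on `A ⊔ A` for the given notion of independence, with
respect to the decomposition `A = ℂ 1 ⊕ ker δ`. (The free product does not use `δ`.) -/
def IsProduct (δ : A →ₐ[ℂ] ℂ) (φ : Fin 2 → A →ₗ[ℂ] ℂ) (Φ : FreeSq A →ₗ[ℂ] ℂ) :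
    Independence → Prop
  | .free => Φ 1 = 1 ∧ ∀ w : List (Fin 2 × A), w ≠ [] → Alternating w →
      (∀ p ∈ w, φ p.1 p.2 = 0) → Φ (wordProd w) = 0
  | .tensor => Φ 1 = 1 ∧ ∀ w : List (Fin 2 × A), w ≠ [] → Alternating w →
      (∀ p ∈ w, δ p.2 = 0) →
      Φ (wordProd w) = φ 0 (legLetters 0 w).prod * φ 1 (legLetters 1 w).prod
  | .boolean => Φ 1 = 1 ∧ ∀ w : List (Fin 2 × A), w ≠ [] → Alternating w →
      (∀ p ∈ w, δ p.2 = 0) →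
      Φ (wordProd w) = (w.map fun p => φ p.1 p.2).prod
  | .monotone => Φ 1 = 1 ∧ ∀ w : List (Fin 2 × A), w ≠ [] → Alternating w →
      (∀ p ∈ w, δ p.2 = 0) →
      Φ (wordProd w) = φ 0 (legLetters 0 w).prod * ((legLetters 1 w).map (φ 1)).prod
  | .antimonotone => Φ 1 = 1 ∧ ∀ w : List (Fin 2 × A), w ≠ [] → Alternating w →
      (∀ p ∈ w, δ p.2 = 0) →
      Φ (wordProd w) = ((legLetters 0 w).map (φ 0)).prod * φ 1 (legLetters 1 w).prod

/-! ### Uniqueness: the alternating words with letters in complements of `ℂ 1` span -/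

theorem wordProd_nil : wordProd ([] : List (Fin 2 × A)) = 1 := rfl

theorem wordProd_cons (p : Fin 2 × A) (w : List (Fin 2 × A)) :
    wordProd (p :: w) = leg p.1 p.2 * wordProd w := by
  simp [wordProd]

theorem adjoin_legs :
    Algebra.adjoin ℂ {x : FreeSq A | ∃ i a, x = leg i a} = ⊤ := by
  set S := Algebra.adjoin ℂ {x : FreeSq A | ∃ i a, x = leg i a} with hS
  have hmem : ∀ (i : Fin 2) (a : A), leg i a ∈ S := fun i a =>
    Algebra.subset_adjoin ⟨i, a, rfl⟩
  let g : (i : Fin 2) → A →ₐ[ℂ] S := fun i => (leg i).codRestrict S (hmem i)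
  let G : FreeSq A →ₐ[ℂ] S := LinearAlgebra.FreeProduct.lift ℂ (fun _ : Fin 2 => A)
    (fun {i} => g i)
  have hG : S.val.comp G = AlgHom.id ℂ _ := by
    apply (LinearAlgebra.FreeProduct.lift ℂ (fun _ : Fin 2 => A)).symm.injective
    funext i
    have h := LinearAlgebra.FreeProduct.lift_comp_ι ℂ (fun _ : Fin 2 => A) (i := i)
      (fun {i} => g i)
    apply AlgHom.ext
    intro a
    have h' := congrArg S.val (DFunLike.congr_fun h a)
    exact h'
  rw [eq_top_iff]
  rintro x -
  have := DFunLike.congr_fun hG x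
  have h2 : S.val (G x) = x := this
  rw [← h2]
  exact (G x).2

theorem span_words (ψ : Fin 2 → A →ₗ[ℂ] ℂ) (hψ : ∀ i, ψ i 1 = 1) :
    Submodule.span ℂ {x : FreeSq A | ∃ w : List (Fin 2 × A), Alternating w ∧
      (∀ p ∈ w, ψ p.1 p.2 = 0) ∧ x = wordProd w} = ⊤ := by
  set T := Submodule.span ℂ {x : FreeSq A | ∃ w : List (Fin 2 × A), Alternating w ∧
      (∀ p ∈ w, ψ p.1 p.2 = 0) ∧ x = wordProd w} with hT
  have hw : ∀ w : List (Fin 2 × A), Alternating w → (∀ p ∈ w, ψ p.1 p.2 = 0) →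
      wordProd w ∈ T := fun w h1 h2 => Submodule.subset_span ⟨w, h1, h2, rfl⟩
  have key0 : ∀ (i : Fin 2) (a : A) (w : List (Fin 2 × A)), Alternating w →
      (∀ p ∈ w, ψ p.1 p.2 = 0) → (∀ p ∈ w.head?, i ≠ p.1) → leg i a * wordProd w ∈ T := by
    intro i a w h1 h2 h3
    have hk : ψ i (a - ψ i a • 1) = 0 := by simp [hψ]
    have e : leg i a = leg i (a - ψ i a • 1) + ψ i a • 1 := by simp
    rw [e, add_mul, smul_mul_assoc, one_mul]
    refine T.add_mem ?_ (T.smul_mem _ (hw w h1 h2))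
    have := hw ((i, a - ψ i a • 1) :: w) ?_ ?_
    · rwa [wordProd_cons] at this
    · cases w with
      | nil => exact List.IsChain.singleton _
      | cons q t => exact List.IsChain.cons_cons (h3 q (by simp)) h1
    · intro p hp
      rcases List.mem_cons.1 hp with rfl | hp
      · exact hk
      · exact h2 p hp
  have key : ∀ (i : Fin 2) (a : A) (x : FreeSq A), x ∈ T → leg i a * x ∈ T := by
    intro i a x hx
    induction hx using Submodule.span_induction with
    | mem x hx =>
      obtain ⟨w, h1, h2, rfl⟩ := hx
      by_cases h3 : ∀ p ∈ w.head?, i ≠ p.1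
      · exact key0 i a w h1 h2 h3
      · cases w with
        | nil => simp at h3
        | cons q t =>
          obtain ⟨j, b⟩ := q
          have hij : i = j := by simpa using h3
          subst hij
          rw [wordProd_cons, ← mul_assoc, ← map_mul]
          refine key0 i _ t ?_ (fun p hp => h2 p (List.mem_cons_of_mem _ hp)) ?_
          · exact List.IsChain.tail h1
          · intro p hp
            cases t with
            | nil => simp at hp
            | cons r s =>
              have : r = p := by simpa using hp
              subst this
              exact (List.isChain_cons_cons.1 h1).1
    | zero => simp
    | add x y _ _ hx hy => rw [mul_add]; exact T.add_mem hx hy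
    | smul c x _ hx => rw [mul_smul_comm]; exact T.smul_mem c hx
  have h1 : (1 : FreeSq A) ∈ T := hw [] List.IsChain.nil (by simp)
  rw [eq_top_iff]
  rintro x -
  have hx : x ∈ Algebra.adjoin ℂ {x : FreeSq A | ∃ i a, x = leg i a} := by
    rw [adjoin_legs]; trivial
  have : ∀ y ∈ T, x * y ∈ T := by
    induction hx using Algebra.adjoin_induction with
    | mem x hx => obtain ⟨i, a, rfl⟩ := hx; exact key i a
    | algebraMap r =>
      intro y hy
      rw [← Algebra.smul_def]
      exact T.smul_mem _ hy
    | add x y _ _ hx hy => intro z hz; rw [add_mul]; exact T.add_mem (hx z hz) (hy z hz)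
    | mul x y _ _ hx hy => intro z hz; rw [mul_assoc]; exact hx _ (hy z hz)
  simpa using this 1 h1

theorem IsProduct.unique {δ : A →ₐ[ℂ] ℂ} {φ : Fin 2 → A →ₗ[ℂ] ℂ} (hφ : ∀ i, φ i 1 = 1)
    {c : Independence} {Φ Ψ : FreeSq A →ₗ[ℂ] ℂ} (h : IsProduct δ φ Φ c) (h' : IsProduct δ φ Ψ c) :
    Φ = Ψ := by
  cases c with
  | free =>
    refine LinearMap.ext_on (span_words φ hφ) ?_
    rintro x ⟨w, h1, h2, rfl⟩
    by_cases hw : w = []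
    · subst hw; rw [wordProd_nil, h.1, h'.1]
    · rw [h.2 w hw h1 h2, h'.2 w hw h1 h2]
  | _ =>
    refine LinearMap.ext_on (span_words (fun _ => δ.toLinearMap) (by simp)) ?_
    rintro x ⟨w, h1, h2, rfl⟩
    by_cases hw : w = []
    · subst hw; rw [wordProd_nil, h.1, h'.1]
    · rw [h.2 w hw h1 h2, h'.2 w hw h1 h2]

/-! ### Existence -/

/-- The action of `A ⊔ A` on `V` given by actions of the two legs. -/
noncomputable def freeLift {V : Type*} [AddCommGroup V] [Module ℂ V]
    (π : Fin 2 → A →ₐ[ℂ] Module.End ℂ V) : FreeSq A →ₐ[ℂ] Module.End ℂ V :=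
  LinearAlgebra.FreeProduct.lift ℂ (fun _ : Fin 2 => A) (fun {i} => π i)

theorem freeLift_leg {V : Type*} [AddCommGroup V] [Module ℂ V]
    (π : Fin 2 → A →ₐ[ℂ] Module.End ℂ V) (i : Fin 2) (a : A) :
    freeLift π (leg i a) = π i a :=
  DFunLike.congr_fun (LinearAlgebra.FreeProduct.lift_comp_ι ℂ (fun _ : Fin 2 => A) (i := i)
      (fun {i} => π i)) a

theorem freeLift_cons {V : Type*} [AddCommGroup V] [Module ℂ V]
    (π : Fin 2 → A →ₐ[ℂ] Module.End ℂ V) (p : Fin 2 × A) (w : List (Fin 2 × A)) (v : V) :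
    freeLift π (wordProd (p :: w)) v = π p.1 p.2 (freeLift π (wordProd w) v) := by
  rw [wordProd_cons, map_mul, freeLift_leg]; rfl

theorem freeLift_nil {V : Type*} [AddCommGroup V] [Module ℂ V]
    (π : Fin 2 → A →ₐ[ℂ] Module.End ℂ V) (v : V) :
    freeLift π (wordProd []) v = v := by
  rw [wordProd_nil, map_one]; rfl

/-- The vector functional `x ↦ θ (x ξ)` of an action. -/
noncomputable def vecFun {V : Type*} [AddCommGroup V] [Module ℂ V]
    (π : Fin 2 → A →ₐ[ℂ] Module.End ℂ V) (ξ : V) (θ : V →ₗ[ℂ] ℂ) : FreeSq A →ₗ[ℂ] ℂ :=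
  θ ∘ₗ LinearMap.applyₗ ξ ∘ₗ (freeLift π).toLinearMap

theorem vecFun_apply {V : Type*} [AddCommGroup V] [Module ℂ V]
    (π : Fin 2 → A →ₐ[ℂ] Module.End ℂ V) (ξ : V) (θ : V →ₗ[ℂ] ℂ) (x : FreeSq A) :
    vecFun π ξ θ x = θ (freeLift π x ξ) := rfl

/-- An action of `A` cut down by a commuting idempotent on `ker δ`. -/
theorem exists_cut {V : Type*} [AddCommGroup V] [Module ℂ V] (δ : A →ₐ[ℂ] ℂ)
    (ρ : A →ₐ[ℂ] Module.End ℂ V) (E : Module.End ℂ V) (hE : E * E = E)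
    (hc : ∀ a, E * ρ a = ρ a * E) :
    ∃ π : A →ₐ[ℂ] Module.End ℂ V, ∀ a, δ a = 0 → π a = ρ a * E := by
  let f : A →ₗ[ℂ] Module.End ℂ V :=
    { toFun := fun a => δ a • (1 - E) + ρ a * E
      map_add' := fun a b => by simp only [map_add, add_smul, add_mul]; abel
      map_smul' := fun c a => by
        simp only [map_smul, smul_eq_mul, mul_smul, smul_add, smul_mul_assoc, RingHom.id_apply] }
  refine ⟨AlgHom.ofLinearMap f ?_ ?_, ?_⟩
  · simp [f]
  · intro a b
    change δ (a * b) • (1 - E) + ρ (a * b) * E =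
      (δ a • (1 - E) + ρ a * E) * (δ b • (1 - E) + ρ b * E)
    have h1 : (1 - E) * (1 - E) = 1 - E := by simp [mul_sub, sub_mul, hE]
    have h2 : ∀ c, (1 - E) * (ρ c * E) = 0 := by
      intro c
      rw [sub_mul, one_mul, ← mul_assoc, hc, mul_assoc, hE, sub_self]
    have h3 : ∀ c, (ρ c * E) * (1 - E) = 0 := by
      intro c
      rw [mul_assoc, mul_sub, mul_one, hE, sub_self, mul_zero]
    have h4 : (ρ a * E) * (ρ b * E) = ρ (a * b) * E := by
      rw [mul_assoc, ← mul_assoc E, hc, mul_assoc (ρ b), hE, ← mul_assoc, map_mul]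
    rw [add_mul, mul_add, mul_add, h4, smul_mul_smul_comm, h1, smul_mul_assoc, h2, mul_smul_comm,
      h3, map_mul]
    simp
  · intro a ha
    change δ a • (1 - E) + ρ a * E = ρ a * E
    rw [ha, zero_smul, zero_add]

/-- The rank one idempotent `a ↦ φ(a) 1`. -/
noncomputable def vacProj (φ : A →ₗ[ℂ] ℂ) : Module.End ℂ A := φ.smulRight 1

/-- Existence of the actions on `A ⊗ A` used for the products other than the free one. -/
theorem exists_tensor_actions (δ : A →ₐ[ℂ] ℂ) (φ : Fin 2 → A →ₗ[ℂ] ℂ) (hφ : ∀ i, φ i 1 = 1)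
    (s t : Bool) :
    ∃ π : Fin 2 → A →ₐ[ℂ] Module.End ℂ (A ⊗[ℂ] A), ∀ a, δ a = 0 → ∀ x y : A,
      π 0 a (x ⊗ₜ y) = (a * x) ⊗ₜ (if s then y else φ 1 y • 1) ∧
      π 1 a (x ⊗ₜ y) = (if t then x else φ 0 x • 1) ⊗ₜ (a * y) := by
  have hP : ∀ i, vacProj (φ i) * vacProj (φ i) = vacProj (φ i) := by
    intro i
    ext x
    simp [vacProj, hφ]
  let E0 : Module.End ℂ A := if s then 1 else vacProj (φ 1)
  let E1 : Module.End ℂ A := if t then 1 else vacProj (φ 0)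
  have hE0 : E0 * E0 = E0 := by
    simp only [E0]; split_ifs
    · simp
    · exact hP 1
  have hE1 : E1 * E1 = E1 := by
    simp only [E1]; split_ifs
    · simp
    · exact hP 0
  let ρ0 : A →ₐ[ℂ] Module.End ℂ (A ⊗[ℂ] A) :=
    AlgHom.ofLinearMap ((LinearMap.rTensorHom A) ∘ₗ (Algebra.lmul ℂ A).toLinearMap)
      (by ext; simp) (by intro a b; ext; simp [mul_assoc])
  let ρ1 : A →ₐ[ℂ] Module.End ℂ (A ⊗[ℂ] A) :=
    AlgHom.ofLinearMap ((LinearMap.lTensorHom A) ∘ₗ (Algebra.lmul ℂ A).toLinearMap)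
      (by ext; simp) (by intro a b; ext; simp [mul_assoc])
  have h00 : ∀ a x y, ρ0 a (x ⊗ₜ y) = (a * x) ⊗ₜ y := fun a x y => rfl
  have h11 : ∀ a x y, ρ1 a (x ⊗ₜ y) = x ⊗ₜ (a * y) := fun a x y => rfl
  obtain ⟨π0, h0⟩ := exists_cut δ ρ0 (LinearMap.lTensor A E0)
    (by rw [Module.End.mul_eq_comp, ← LinearMap.lTensor_comp, ← Module.End.mul_eq_comp, hE0])
    (by intro a; apply TensorProduct.ext'; intro x y; simp [h00])
  obtain ⟨π1, h1⟩ := exists_cut δ ρ1 (LinearMap.rTensor A E1)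
    (by rw [Module.End.mul_eq_comp, ← LinearMap.rTensor_comp, ← Module.End.mul_eq_comp, hE1])
    (by intro a; apply TensorProduct.ext'; intro x y; simp [h11])
  refine ⟨![π0, π1], fun a ha x y => ⟨?_, ?_⟩⟩
  · change π0 a _ = _
    rw [h0 a ha, Module.End.mul_apply, LinearMap.lTensor_tmul, h00]
    simp only [E0, vacProj]
    split_ifs <;> simp
  · change π1 a _ = _
    rw [h1 a ha, Module.End.mul_apply, LinearMap.rTensor_tmul, h11]
    simp only [E1, vacProj]
    split_ifs <;> simp

/-- The functional `φ 0 ⊗ φ 1` on `A ⊗ A`. -/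
noncomputable def tensorFun (φ : Fin 2 → A →ₗ[ℂ] ℂ) : A ⊗[ℂ] A →ₗ[ℂ] ℂ :=
  LinearMap.mul' ℂ ℂ ∘ₗ TensorProduct.map (φ 0) (φ 1)

theorem tensorFun_tmul (φ : Fin 2 → A →ₗ[ℂ] ℂ) (x y : A) :
    tensorFun φ (x ⊗ₜ y) = φ 0 x * φ 1 y := by
  simp [tensorFun]

theorem legLetters_cons (i : Fin 2) (p : Fin 2 × A) (w : List (Fin 2 × A)) :
    legLetters i (p :: w) = if p.1 = i then p.2 :: legLetters i w else legLetters i w := by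
  by_cases h : p.1 = i <;> simp [legLetters, h]

theorem exists_tensor_product (δ : A →ₐ[ℂ] ℂ) (φ : Fin 2 → A →ₗ[ℂ] ℂ) (hφ : ∀ i, φ i 1 = 1) :
    ∃ Φ, IsProduct δ φ Φ .tensor := by
  obtain ⟨π, hπ⟩ := exists_tensor_actions δ φ hφ true true
  refine ⟨vecFun π (1 ⊗ₜ 1) (tensorFun φ), ?_, ?_⟩
  · rw [vecFun_apply, map_one, Module.End.one_apply, tensorFun_tmul, hφ, hφ, one_mul]
  · rintro w - - hw
    suffices h : freeLift π (wordProd w) (1 ⊗ₜ 1) =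
        (legLetters 0 w).prod ⊗ₜ (legLetters 1 w).prod by
      rw [vecFun_apply, h, tensorFun_tmul]
    induction w with
    | nil => rw [freeLift_nil]; rfl
    | cons p t ih =>
      obtain ⟨i, a⟩ := p
      have ha : δ a = 0 := hw (i, a) (by simp)
      rw [freeLift_cons, ih (fun p hp => hw p (List.mem_cons_of_mem _ hp))]
      fin_cases i
      · simpa [legLetters_cons] using (hπ a ha _ _).1
      · simpa [legLetters_cons] using (hπ a ha _ _).2

theorem alternating_tail {p : Fin 2 × A} {w : List (Fin 2 × A)} (h : Alternating (p :: w)) :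
    Alternating w := List.IsChain.tail h

theorem exists_boolean_product (δ : A →ₐ[ℂ] ℂ) (φ : Fin 2 → A →ₗ[ℂ] ℂ) (hφ : ∀ i, φ i 1 = 1) :
    ∃ Φ, IsProduct δ φ Φ .boolean := by
  obtain ⟨π, hπ⟩ := exists_tensor_actions δ φ hφ false false
  refine ⟨vecFun π (1 ⊗ₜ 1) (tensorFun φ), ?_, ?_⟩
  · rw [vecFun_apply, map_one, Module.End.one_apply, tensorFun_tmul, hφ, hφ, one_mul]
  · have key : ∀ (t : List (Fin 2 × A)) (i : Fin 2) (a : A), Alternating ((i, a) :: t) →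
        (∀ p ∈ (i, a) :: t, δ p.2 = 0) →
        freeLift π (wordProd ((i, a) :: t)) (1 ⊗ₜ 1) =
          (t.map fun p => φ p.1 p.2).prod • (if i = 0 then a ⊗ₜ[ℂ] (1 : A) else 1 ⊗ₜ a) := by
      intro t
      induction t with
      | nil =>
        intro i a _ hw
        have ha : δ a = 0 := hw (i, a) (by simp)
        rw [freeLift_cons, freeLift_nil]
        fin_cases i
        · simpa [hφ] using (hπ a ha 1 1).1
        · simpa [hφ] using (hπ a ha 1 1).2
      | cons q t ih =>
        intro i a h1 hw
        obtain ⟨j, b⟩ := q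
        have ha : δ a = 0 := hw (i, a) (by simp)
        have hij : i ≠ j := (List.isChain_cons_cons.1 h1).1
        rw [freeLift_cons, ih j b (alternating_tail h1)
          (fun p hp => hw p (List.mem_cons_of_mem _ hp)), map_smul]
        fin_cases i <;> fin_cases j
        · exact absurd rfl hij
        · have := (hπ a ha 1 b).1
          simp only [Bool.false_eq_true, if_false, TensorProduct.tmul_smul] at this
          simp [this, smul_smul, mul_comm]
        · have := (hπ a ha b 1).2
          simp only [Bool.false_eq_true, if_false, ← TensorProduct.smul_tmul'] at this
          simp [this, smul_smul, mul_comm]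
        · exact absurd rfl hij
    intro w hne h1 hw
    cases w with
    | nil => exact absurd rfl hne
    | cons p t =>
      obtain ⟨i, a⟩ := p
      rw [vecFun_apply, key t i a h1 hw, map_smul]
      fin_cases i <;> simp [tensorFun_tmul, hφ, mul_comm]

theorem exists_monotone_product (δ : A →ₐ[ℂ] ℂ) (φ : Fin 2 → A →ₗ[ℂ] ℂ) (hφ : ∀ i, φ i 1 = 1) :
    ∃ Φ, IsProduct δ φ Φ .monotone := by
  obtain ⟨π, hπ⟩ := exists_tensor_actions δ φ hφ false true
  refine ⟨vecFun π (1 ⊗ₜ 1) (tensorFun φ), ?_, ?_⟩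
  · rw [vecFun_apply, map_one, Module.End.one_apply, tensorFun_tmul, hφ, hφ, one_mul]
  · have key : ∀ w : List (Fin 2 × A), Alternating w → (∀ p ∈ w, δ p.2 = 0) →
        ∃ y : A, freeLift π (wordProd w) (1 ⊗ₜ 1) = (legLetters 0 w).prod ⊗ₜ y ∧
          φ 1 y = ((legLetters 1 w).map (φ 1)).prod ∧
          ((∀ p ∈ w.head?, p.1 = 0) → y = ((legLetters 1 w).map (φ 1)).prod • 1) := by
      intro w
      induction w with
      | nil =>
        intro _ _
        refine ⟨1, ?_, ?_, ?_⟩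
        · rw [freeLift_nil]; rfl
        · simp [hφ, legLetters]
        · simp [legLetters]
      | cons p t ih =>
        intro h1 hw
        obtain ⟨i, a⟩ := p
        have ha : δ a = 0 := hw (i, a) (by simp)
        obtain ⟨y, e1, e2, e3⟩ := ih (alternating_tail h1)
          (fun p hp => hw p (List.mem_cons_of_mem _ hp))
        rw [freeLift_cons, e1]
        fin_cases i
        · refine ⟨φ 1 y • 1, ?_, ?_, ?_⟩
          · simpa [legLetters_cons] using (hπ a ha _ y).1
          · simp [hφ, e2, legLetters_cons]
          · intro _
            simp [e2, legLetters_cons]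
        · have ht : ∀ p ∈ t.head?, p.1 = 0 := by
            intro p hp
            cases t with
            | nil => simp at hp
            | cons q s =>
              have hq : q = p := by simpa using hp
              subst hq
              have := (List.isChain_cons_cons.1 h1).1
              have h' : (1 : Fin 2) ≠ q.1 := this
              omega
          refine ⟨a * y, ?_, ?_, ?_⟩
          · simpa [legLetters_cons] using (hπ a ha _ y).2
          · rw [e3 ht]
            simp [legLetters_cons, mul_comm]
          · intro h
            have := h (1, a) (by simp)
            simp at this
    intro w _ h1 hw
    obtain ⟨y, e1, e2, _⟩ := key w h1 hw
    rw [vecFun_apply, e1, tensorFun_tmul, e2]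

theorem exists_antimonotone_product (δ : A →ₐ[ℂ] ℂ) (φ : Fin 2 → A →ₗ[ℂ] ℂ)
    (hφ : ∀ i, φ i 1 = 1) : ∃ Φ, IsProduct δ φ Φ .antimonotone := by
  obtain ⟨π, hπ⟩ := exists_tensor_actions δ φ hφ true false
  refine ⟨vecFun π (1 ⊗ₜ 1) (tensorFun φ), ?_, ?_⟩
  · rw [vecFun_apply, map_one, Module.End.one_apply, tensorFun_tmul, hφ, hφ, one_mul]
  · have key : ∀ w : List (Fin 2 × A), Alternating w → (∀ p ∈ w, δ p.2 = 0) →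
        ∃ x : A, freeLift π (wordProd w) (1 ⊗ₜ 1) = x ⊗ₜ (legLetters 1 w).prod ∧
          φ 0 x = ((legLetters 0 w).map (φ 0)).prod ∧
          ((∀ p ∈ w.head?, p.1 = 1) → x = ((legLetters 0 w).map (φ 0)).prod • 1) := by
      intro w
      induction w with
      | nil =>
        intro _ _
        refine ⟨1, ?_, ?_, ?_⟩
        · rw [freeLift_nil]; rfl
        · simp [hφ, legLetters]
        · simp [legLetters]
      | cons p t ih =>
        intro h1 hw
        obtain ⟨i, a⟩ := p
        have ha : δ a = 0 := hw (i, a) (by simp)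
        obtain ⟨x, e1, e2, e3⟩ := ih (alternating_tail h1)
          (fun p hp => hw p (List.mem_cons_of_mem _ hp))
        rw [freeLift_cons, e1]
        fin_cases i
        · have ht : ∀ p ∈ t.head?, p.1 = 1 := by
            intro p hp
            cases t with
            | nil => simp at hp
            | cons q s =>
              have hq : q = p := by simpa using hp
              subst hq
              have := (List.isChain_cons_cons.1 h1).1
              have h' : (0 : Fin 2) ≠ q.1 := this
              omega
          refine ⟨a * x, ?_, ?_, ?_⟩
          · simpa [legLetters_cons] using (hπ a ha x _).1
          · rw [e3 ht]
            simp [legLetters_cons, mul_comm]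
          · intro h
            have := h (0, a) (by simp)
            simp at this
        · refine ⟨φ 0 x • 1, ?_, ?_, ?_⟩
          · simpa [legLetters_cons] using (hπ a ha x _).2
          · simp [hφ, e2, legLetters_cons]
          · intro _
            simp [e2, legLetters_cons]
    intro w _ h1 hw
    obtain ⟨x, e1, e2, _⟩ := key w h1 hw
    rw [vecFun_apply, e1, tensorFun_tmul, e2]

universe u

/-- A basis of `A` adapted to `A = ℂ 1 ⊕ ker φ`. -/
theorem exists_basis {A : Type u} [Ring A] [Algebra ℂ A] (φ : A →ₗ[ℂ] ℂ) (hφ : φ 1 = 1) :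
    ∃ (J : Type u) (b : Module.Basis (Unit ⊕ J) ℂ A), b (Sum.inl ()) = 1 ∧
      ∀ a, b.repr a (Sum.inl ()) = φ a := by
  let e : A ≃ₗ[ℂ] ℂ × LinearMap.ker φ :=
    { toFun := fun a => (φ a, ⟨a - φ a • 1, by simp [hφ]⟩)
      map_add' := fun a b => by
        ext
        · simp
        · simp [add_smul]; abel
      map_smul' := fun c a => by
        ext
        · simp
        · simp [smul_sub, mul_smul]
      invFun := fun x => x.1 • 1 + x.2.1
      left_inv := fun a => by simp
      right_inv := fun x => by
        obtain ⟨c, k, hk⟩ := x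
        have hk' : φ k = 0 := hk
        ext <;> simp [hφ, hk'] }
  let bk := Module.Basis.ofVectorSpace ℂ (LinearMap.ker φ)
  refine ⟨_, ((Module.Basis.singleton Unit ℂ).prod bk).map e.symm, ?_, ?_⟩
  · rw [Module.Basis.map_apply, Module.Basis.prod_apply]
    simp [e]
  · intro a
    simp [e]

section Fock

variable (J : Fin 2 → Type*)

/-- Alternating words in the basis labels. -/
abbrev FockWord : Type _ := {l : List (Σ i, J i) // l.IsChain fun p q => p.1 ≠ q.1}

/-- Alternating words that do not start in the leg `i`. -/
abbrev FockOff (i : Fin 2) : Type _ := {w : FockWord J // ∀ p ∈ w.1.head?, i ≠ p.1}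

variable {J}

/-- Prepend a letter of the leg `i`, or nothing. -/
def fockCons (i : Fin 2) : FockOff J i × (Unit ⊕ J i) → FockWord J
  | (w, Sum.inl _) => w.1
  | (w, Sum.inr j) => ⟨⟨i, j⟩ :: w.1.1, by
      obtain ⟨⟨w, h1⟩, h2⟩ := w
      cases w with
      | nil => exact List.IsChain.singleton _
      | cons q t => exact List.IsChain.cons_cons (h2 q (by simp)) h1⟩

theorem fockCons_bijective (i : Fin 2) : Function.Bijective (fockCons (J := J) i) := by
  constructor
  · rintro ⟨⟨⟨w, h1⟩, h2⟩, x⟩ ⟨⟨⟨w', h1'⟩, h2'⟩, x'⟩ h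
    have h := congrArg Subtype.val h
    rcases x with x | j <;> rcases x' with x' | j' <;> simp only [fockCons] at h
    · subst h; rfl
    · subst h
      exact absurd rfl (h2 ⟨i, j'⟩ (by simp))
    · subst h
      exact absurd rfl (h2' ⟨i, j⟩ (by simp))
    · simp only [List.cons.injEq, Sigma.mk.injEq, heq_eq_eq, true_and] at h
      obtain ⟨rfl, rfl⟩ := h
      rfl
  · rintro ⟨w, h1⟩
    by_cases h2 : ∀ p ∈ w.head?, i ≠ p.1
    · exact ⟨(⟨⟨w, h1⟩, h2⟩, Sum.inl ()), rfl⟩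
    · cases w with
      | nil => simp at h2
      | cons q t =>
        obtain ⟨k, j⟩ := q
        have hik : i = k := by simpa using h2
        subst hik
        refine ⟨(⟨⟨t, List.IsChain.tail h1⟩, ?_⟩, Sum.inr j), rfl⟩
        intro p hp
        cases t with
        | nil => simp at hp
        | cons r s =>
          have : r = p := by simpa using hp
          subst this
          exact (List.isChain_cons_cons.1 h1).1

end Fock

theorem exists_free_product (δ : A →ₐ[ℂ] ℂ) (φ : Fin 2 → A →ₗ[ℂ] ℂ) (hφ : ∀ i, φ i 1 = 1) :
    ∃ Φ, IsProduct δ φ Φ .free := by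
  choose J b hb1 hb using fun i => exists_basis (φ i) (hφ i)
  let σ : (i : Fin 2) → FockOff J i × (Unit ⊕ J i) ≃ FockWord J := fun i =>
    Equiv.ofBijective _ (fockCons_bijective i)
  let e : (i : Fin 2) → (FockWord J →₀ ℂ) ≃ₗ[ℂ] (FockOff J i →₀ A) := fun i =>
    Finsupp.domLCongr (σ i).symm ≪≫ₗ Finsupp.curryLinearEquiv ℂ ≪≫ₗ
      Finsupp.mapRange.linearEquiv (b i).repr.symm
  let π : Fin 2 → A →ₐ[ℂ] Module.End ℂ (FockWord J →₀ ℂ) := fun i =>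
    ((e i).symm.conjAlgEquiv ℂ).toAlgHom.comp (Algebra.lsmul ℂ ℂ (FockOff J i →₀ A))
  have hπ : ∀ i a v, π i a v = (e i).symm (a • e i v) := fun i a v => rfl
  have he1 : ∀ i (v : FockWord J →₀ ℂ) (x : FockOff J i) k,
      (b i).repr (e i v x) k = v (fockCons i (x, k)) := by
    intro i v x k
    simp only [e, LinearEquiv.trans_apply, Finsupp.mapRange.linearEquiv_apply,
      Finsupp.mapRange.linearMap_apply, Finsupp.mapRange_apply]
    simp [σ, Finsupp.domLCongr, Finsupp.curryLinearEquiv]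
  have hcut : ∀ i a (v : FockWord J →₀ ℂ), φ i a = 0 →
      (∀ w : FockWord J, (∃ p ∈ w.1.head?, i = p.1) → v w = 0) →
      ∀ x : FockOff J i, π i a v x.1 = 0 := by
    intro i a v ha hv x
    have h1 : e i v x = v x.1 • 1 := by
      apply (b i).repr.injective
      ext k
      rw [he1, ← hb1 i, map_smul, Module.Basis.repr_self]
      rcases k with k | j
      · simp [fockCons]
      · have : v (fockCons i (x, Sum.inr j)) = 0 := hv _ ⟨⟨i, j⟩, by simp [fockCons], rfl⟩
        simp [this]
    have h2 := he1 i (π i a v) x (Sum.inl ())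
    rw [hb, hπ, LinearEquiv.apply_symm_apply, Finsupp.smul_apply, h1, smul_eq_mul,
      mul_smul_comm, mul_one, map_smul, ha, smul_zero] at h2
    rw [hπ]
    exact h2.symm
  let ξ : FockWord J →₀ ℂ := Finsupp.single ⟨[], List.IsChain.nil⟩ 1
  refine ⟨vecFun π ξ (Finsupp.lapply ⟨[], List.IsChain.nil⟩), ?_, ?_⟩
  · rw [vecFun_apply, map_one, Module.End.one_apply]
    simp [ξ]
  · have key : ∀ (t : List (Fin 2 × A)) (i : Fin 2) (a : A), Alternating ((i, a) :: t) →
        (∀ p ∈ (i, a) :: t, φ p.1 p.2 = 0) → ∀ x : FockOff J i,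
        freeLift π (wordProd ((i, a) :: t)) ξ x.1 = 0 := by
      intro t
      induction t with
      | nil =>
        intro i a _ hw x
        rw [freeLift_cons, freeLift_nil]
        refine hcut i a ξ (hw (i, a) (by simp)) ?_ x
        rintro ⟨w, hw⟩ ⟨p, hp, _⟩
        refine Finsupp.single_eq_of_ne ?_
        intro h
        have := congrArg Subtype.val h
        simp only at this
        subst this
        simp at hp
      | cons q t ih =>
        intro i a h1 hw x
        obtain ⟨j, c⟩ := q
        rw [freeLift_cons]
        refine hcut i a _ (hw (i, a) (by simp)) ?_ x
        rintro w ⟨p, hp, hip⟩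
        have hij : i ≠ j := (List.isChain_cons_cons.1 h1).1
        refine ih j c (alternating_tail h1) (fun p hp => hw p (List.mem_cons_of_mem _ hp))
          ⟨w, ?_⟩
        intro p' hp'
        have : p = p' := Option.mem_unique hp hp'
        rw [← this, ← hip]
        exact hij.symm
    intro w hne h1 hw
    cases w with
    | nil => exact absurd rfl hne
    | cons p t =>
      exact key t p.1 p.2 h1 hw ⟨⟨[], List.IsChain.nil⟩, by simp⟩

theorem existsUnique_product (c : Independence) (δ : A →ₐ[ℂ] ℂ) (φ : Fin 2 → A →ₗ[ℂ] ℂ)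
    (hφ : ∀ i, φ i 1 = 1) : ∃! Φ, IsProduct δ φ Φ c := by
  have h : ∃ Φ, IsProduct δ φ Φ c := by
    cases c with
    | free => exact exists_free_product δ φ hφ
    | tensor => exact exists_tensor_product δ φ hφ
    | boolean => exact exists_boolean_product δ φ hφ
    | monotone => exact exists_monotone_product δ φ hφ
    | antimonotone => exact exists_antimonotone_product δ φ hφ
  obtain ⟨Φ, hΦ⟩ := h
  exact ⟨Φ, hΦ, fun Ψ hΨ => IsProduct.unique hφ hΨ hΦ⟩

/-- The product of two states on `A ⊔ A` for the given notion of independence, with respect to the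
decomposition `A = ℂ 1 ⊕ ker δ`: the unique functional with the property `IsProduct`. -/
noncomputable def prodState [StarRing A] (c : Independence) (δ : A →ₐ[ℂ] ℂ) (φ ψ : State A) :
    FreeSq A →ₗ[ℂ] ℂ :=
  (existsUnique_product c δ ![φ.toLin, ψ.toLin]
    (Fin.forall_fin_two.2 ⟨φ.map_one', ψ.map_one'⟩)).choose

theorem prodState_spec [StarRing A] (c : Independence) (δ : A →ₐ[ℂ] ℂ) (φ ψ : State A) :
    IsProduct δ ![φ.toLin, ψ.toLin] (prodState c δ φ ψ) c :=
  (existsUnique_product c δ ![φ.toLin, ψ.toLin]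
    (Fin.forall_fin_two.2 ⟨φ.map_one', ψ.map_one'⟩)).choose_spec.1

end Products

end NCProb

/-! ## The unitary dual group -/

namespace UnitaryDual

open NCProb

/-- The generators `u i j` and their formal adjoints `us i j`. -/
inductive Gen (n : ℕ)
  | u (i j : Fin n)
  | us (i j : Fin n)

/-- The relations `∑ₖ uₖᵢ* uₖⱼ = δᵢⱼ = ∑ₖ uᵢₖ uⱼₖ*`. -/
inductive Rel (n : ℕ) : FreeAlgebra ℂ (Gen n) → FreeAlgebra ℂ (Gen n) → Prop
  | left (i j : Fin n) :
      Rel n (∑ k, FreeAlgebra.ι ℂ (Gen.us k i) * FreeAlgebra.ι ℂ (Gen.u k j))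
        (if i = j then 1 else 0)
  | right (i j : Fin n) :
      Rel n (∑ k, FreeAlgebra.ι ℂ (Gen.u i k) * FreeAlgebra.ι ℂ (Gen.us j k))
        (if i = j then 1 else 0)

/-- The universal unital `*`-algebra generated by the entries of a unitary `n × n` matrix. -/
def Unc (n : ℕ) : Type := RingQuot (Rel n)

noncomputable instance (n : ℕ) : Ring (Unc n) := inferInstanceAs (Ring (RingQuot (Rel n)))

noncomputable instance (n : ℕ) : Algebra ℂ (Unc n) :=
  inferInstanceAs (Algebra ℂ (RingQuot (Rel n)))

namespace Unc

variable {n : ℕ}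

/-- The quotient map from the free algebra. -/
noncomputable def mk (n : ℕ) : FreeAlgebra ℂ (Gen n) →ₐ[ℂ] Unc n := RingQuot.mkAlgHom ℂ (Rel n)

/-- The generator `uᵢⱼ`. -/
noncomputable def u (i j : Fin n) : Unc n := mk n (FreeAlgebra.ι ℂ (Gen.u i j))

/-- The generator `uᵢⱼ*`; see `star_u`. -/
noncomputable def us (i j : Fin n) : Unc n := mk n (FreeAlgebra.ι ℂ (Gen.us i j))

theorem sum_us_mul_u (i j : Fin n) :
    ∑ k, us k i * u k j = if i = j then 1 else 0 := by
  have h := RingQuot.mkAlgHom_rel ℂ (Rel.left i j)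
  have h' : mk n _ = mk n _ := h
  simpa [u, us, apply_ite, map_sum] using h'

theorem sum_u_mul_us (i j : Fin n) :
    ∑ k, u i k * us j k = if i = j then 1 else 0 := by
  have h := RingQuot.mkAlgHom_rel ℂ (Rel.right i j)
  have h' : mk n _ = mk n _ := h
  simpa [u, us, apply_ite, map_sum] using h'

theorem induction {P : Unc n → Prop} (scalar : ∀ c : ℂ, P (algebraMap ℂ _ c))
    (gen : ∀ i j, P (u i j)) (gen_star : ∀ i j, P (us i j))
    (add : ∀ a b, P a → P b → P (a + b)) (mul : ∀ a b, P a → P b → P (a * b)) (a : Unc n) :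
    P a := by
  obtain ⟨x, rfl⟩ : ∃ x, mk n x = a := RingQuot.mkAlgHom_surjective ℂ (Rel n) a
  induction x using FreeAlgebra.induction with
  | grade0 c => rw [AlgHom.commutes]; exact scalar c
  | grade1 g =>
    cases g with
    | u i j => exact gen i j
    | us i j => exact gen_star i j
  | mul a b ha hb => rw [map_mul]; exact mul _ _ ha hb
  | add a b ha hb => rw [map_add]; exact add _ _ ha hb

/-- The algebra homomorphism with `uᵢⱼ ↦ v i j` and `uᵢⱼ* ↦ w i j`. -/
noncomputable def lift {B : Type*} [Semiring B] [Algebra ℂ B] (v w : Fin n → Fin n → B)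
    (h₁ : ∀ i j, ∑ k, w k i * v k j = if i = j then 1 else 0)
    (h₂ : ∀ i j, ∑ k, v i k * w j k = if i = j then 1 else 0) : Unc n →ₐ[ℂ] B :=
  RingQuot.liftAlgHom ℂ ⟨FreeAlgebra.lift ℂ fun
    | Gen.u i j => v i j
    | Gen.us i j => w i j, by
      intro x y h
      cases h with
      | left i j => simpa [apply_ite, map_sum] using h₁ i j
      | right i j => simpa [apply_ite, map_sum] using h₂ i j⟩

section lift

variable {B : Type*} [Semiring B] [Algebra ℂ B] (v w : Fin n → Fin n → B)
    (h₁ : ∀ i j, ∑ k, w k i * v k j = if i = j then 1 else 0)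
    (h₂ : ∀ i j, ∑ k, v i k * w j k = if i = j then 1 else 0)

theorem lift_u (i j : Fin n) : lift v w h₁ h₂ (u i j) = v i j := by
  have := RingQuot.liftAlgHom_mkAlgHom_apply ℂ (FreeAlgebra.lift ℂ fun
    | Gen.u i j => v i j
    | Gen.us i j => w i j) (s := Rel n) (by
      intro x y h
      cases h with
      | left i j => simpa [apply_ite, map_sum] using h₁ i j
      | right i j => simpa [apply_ite, map_sum] using h₂ i j) (FreeAlgebra.ι ℂ (Gen.u i j))
  rw [FreeAlgebra.lift_ι_apply] at this
  exact this

theorem lift_us (i j : Fin n) : lift v w h₁ h₂ (us i j) = w i j := by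
  have := RingQuot.liftAlgHom_mkAlgHom_apply ℂ (FreeAlgebra.lift ℂ fun
    | Gen.u i j => v i j
    | Gen.us i j => w i j) (s := Rel n) (by
      intro x y h
      cases h with
      | left i j => simpa [apply_ite, map_sum] using h₁ i j
      | right i j => simpa [apply_ite, map_sum] using h₂ i j) (FreeAlgebra.ι ℂ (Gen.us i j))
  rw [FreeAlgebra.lift_ι_apply] at this
  exact this

end lift

/-! ### The involution -/

/-- A copy of the opposite algebra of `Unc n` with conjugated scalars. -/
def Conj (n : ℕ) : Type := (Unc n)ᵐᵒᵖ

noncomputable instance (n : ℕ) : Ring (Conj n) := inferInstanceAs (Ring (Unc n)ᵐᵒᵖ)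

noncomputable instance (n : ℕ) : Algebra ℂ (Conj n) :=
  RingHom.toAlgebra' ((algebraMap ℂ (Unc n)ᵐᵒᵖ).comp (starRingEnd ℂ))
    (fun c x => Algebra.commutes (R := ℂ) (A := (Unc n)ᵐᵒᵖ) (starRingEnd ℂ c) x)

/-- The involution as a homomorphism to the conjugate opposite algebra. -/
noncomputable def starHom (n : ℕ) : Unc n →ₐ[ℂ] Conj n :=
  lift (B := Conj n) (fun i j => MulOpposite.op (us i j)) (fun i j => MulOpposite.op (u i j))
    (by
      intro i j
      have h := congrArg MulOpposite.op (sum_us_mul_u (n := n) j i)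
      rw [Finset.op_sum] at h
      simp only [MulOpposite.op_mul] at h
      refine h.trans ?_
      by_cases hij : i = j
      · subst hij; simp; rfl
      · rw [if_neg hij, if_neg (Ne.symm hij)]; rfl)
    (by
      intro i j
      have h := congrArg MulOpposite.op (sum_u_mul_us (n := n) j i)
      rw [Finset.op_sum] at h
      simp only [MulOpposite.op_mul] at h
      refine h.trans ?_
      by_cases hij : i = j
      · subst hij; simp; rfl
      · rw [if_neg hij, if_neg (Ne.symm hij)]; rfl)

/-- The involution, as a function. -/
noncomputable def starFun (a : Unc n) : Unc n := MulOpposite.unop (α := Unc n) (starHom n a)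

theorem starFun_add (a b : Unc n) : starFun (a + b) = starFun a + starFun b := by
  unfold starFun; rw [map_add]; rfl

theorem starFun_mul (a b : Unc n) : starFun (a * b) = starFun b * starFun a := by
  unfold starFun; rw [map_mul]; rfl

theorem starFun_algebraMap (c : ℂ) :
    starFun (algebraMap ℂ (Unc n) c) = algebraMap ℂ (Unc n) (star c) := by
  unfold starFun; rw [AlgHom.commutes]; rfl

theorem starFun_u (i j : Fin n) : starFun (u i j) = us i j :=
  congrArg (MulOpposite.unop (α := Unc n)) (lift_u (B := Conj n) _ _ _ _ i j)

theorem starFun_us (i j : Fin n) : starFun (us i j) = u i j :=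
  congrArg (MulOpposite.unop (α := Unc n)) (lift_us (B := Conj n) _ _ _ _ i j)

theorem starFun_starFun (a : Unc n) : starFun (starFun a) = a := by
  induction a using induction with
  | scalar c => rw [starFun_algebraMap, starFun_algebraMap, star_star]
  | gen i j => rw [starFun_u, starFun_us]
  | gen_star i j => rw [starFun_us, starFun_u]
  | add a b ha hb => rw [starFun_add, starFun_add, ha, hb]
  | mul a b ha hb => rw [starFun_mul, starFun_mul, ha, hb]

noncomputable instance : StarRing (Unc n) where
  star := starFun
  star_involutive := starFun_starFun
  star_mul := starFun_mul
  star_add := starFun_add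

instance : StarModule ℂ (Unc n) where
  star_smul c a := by
    rw [Algebra.smul_def, star_mul, Algebra.smul_def, Algebra.commutes]
    exact congrArg (star a * ·) (starFun_algebraMap c)

theorem star_u (i j : Fin n) : star (u i j) = us i j := starFun_u i j

/-! ### The dual group structure and the convolutions -/

/-- The counit `δ(uᵢⱼ) = δᵢⱼ`. -/
noncomputable def counit (n : ℕ) : Unc n →ₐ[ℂ] ℂ :=
  lift (fun i j => if i = j then 1 else 0) (fun i j => if i = j then 1 else 0)
    (by intro i j; simp [eq_comm]) (by intro i j; simp [eq_comm])

theorem sum_four {B : Type*} [Semiring B] (a b c d : Fin n → Fin n → B)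
    (hbc : ∀ p q, ∑ k, b k p * c k q = if p = q then 1 else 0)
    (had : ∀ p q, ∑ k, a k p * d k q = if p = q then 1 else 0) (i j : Fin n) :
    ∑ k, (∑ p, a p i * b k p) * (∑ q, c k q * d q j) = if i = j then 1 else 0 := by
  calc ∑ k, (∑ p, a p i * b k p) * (∑ q, c k q * d q j)
      = ∑ k, ∑ p, ∑ q, a p i * (b k p * c k q) * d q j := by
        simp only [Finset.sum_mul_sum, mul_assoc]
    _ = ∑ p, ∑ q, a p i * (∑ k, b k p * c k q) * d q j := by
        rw [Finset.sum_comm]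
        refine Finset.sum_congr rfl fun p _ => ?_
        rw [Finset.sum_comm]
        refine Finset.sum_congr rfl fun q _ => ?_
        rw [Finset.mul_sum, Finset.sum_mul]
    _ = if i = j then 1 else 0 := by
        simp only [hbc]
        simp [had]

/-- The coproduct `Δ(uᵢⱼ) = ∑ₖ uᵢₖ⁽¹⁾ uₖⱼ⁽²⁾`; being a `*`-homomorphism, it maps `uᵢⱼ*` to
`∑ₖ uₖⱼ*⁽²⁾ uᵢₖ*⁽¹⁾`. -/
noncomputable def coproduct (n : ℕ) : Unc n →ₐ[ℂ] FreeSq (Unc n) :=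
  lift (fun i j => ∑ k, leg 0 (u i k) * leg 1 (u k j))
    (fun i j => ∑ k, leg 1 (star (u k j)) * leg 0 (star (u i k)))
    (by
      intro i j
      refine sum_four (fun p i => leg 1 (star (u p i))) (fun k p => leg 0 (star (u k p)))
        (fun k q => leg 0 (u k q)) (fun q j => leg 1 (u q j)) ?_ ?_ i j
      · intro p q
        simp only [star_u, ← map_mul, ← map_sum, sum_us_mul_u]
        split_ifs <;> simp
      · intro p q
        simp only [star_u, ← map_mul, ← map_sum, sum_us_mul_u]
        split_ifs <;> simp)
    (by
      intro i j
      refine sum_four (fun p i => leg 0 (u i p)) (fun k p => leg 1 (u p k))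
        (fun k q => leg 1 (star (u q k))) (fun q j => leg 0 (star (u j q))) ?_ ?_ i j
      · intro p q
        simp only [star_u, ← map_mul, ← map_sum, sum_u_mul_us]
        split_ifs <;> simp
      · intro p q
        simp only [star_u, ← map_mul, ← map_sum, sum_u_mul_us]
        split_ifs <;> simp)

/-- The convolution `(φ · ψ) ∘ Δ` of two states on `U⟨n⟩`, where `·` is the product of states for
the given notion of independence and the decomposition `ℂ 1 ⊕ ker δ`, with `δ` the counit. -/
noncomputable def convolution (c : Independence) (φ ψ : State (Unc n)) : Unc n →ₗ[ℂ] ℂ :=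
  prodState c (counit n) φ ψ ∘ₗ (coproduct n).toLinearMap

/-- `h` is a Haar state on `U⟨n⟩`: it absorbs all states on both sides. -/
def IsHaarState (c : Independence) (h : State (Unc n)) : Prop :=
  ∀ φ : State (Unc n), convolution c φ h = h.toLin ∧ convolution c h φ = h.toLin

/-! ### Measures on the circle as states on `U⟨1⟩` -/

/-- Evaluation of an element of `U⟨1⟩` at a point of the circle: `u ↦ z`, `u* ↦ conj z`. -/
noncomputable def evalCircle (z : Circle) : Unc 1 →ₐ[ℂ] ℂ :=
  lift (fun _ _ => (z : ℂ)) (fun _ _ => star (z : ℂ))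
    (by intro i j; rw [Subsingleton.elim i j]; simp [mul_comm, Complex.mul_conj])
    (by intro i j; rw [Subsingleton.elim i j]; simp [Complex.mul_conj])

theorem continuous_evalCircle (a : Unc 1) : Continuous fun z => evalCircle z a := by
  induction a using induction with
  | scalar c => simp only [AlgHom.commutes]; exact continuous_const
  | gen i j => simp only [evalCircle, lift_u]; exact continuous_subtype_val
  | gen_star i j => simp only [evalCircle, lift_us]; exact continuous_star.comp continuous_subtype_val
  | add a b ha hb => simp only [map_add]; exact ha.add hb
  | mul a b ha hb => simp only [map_mul]; exact ha.mul hb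

theorem evalCircle_star (z : Circle) (a : Unc 1) :
    evalCircle z (star a) = star (evalCircle z a) := by
  induction a using induction with
  | scalar c =>
    rw [show star (algebraMap ℂ (Unc 1) c) = algebraMap ℂ (Unc 1) (star c) from
      starFun_algebraMap c, AlgHom.commutes, AlgHom.commutes]
    rfl
  | gen i j => rw [star_u, evalCircle, lift_us, lift_u]
  | gen_star i j => rw [← star_u, star_star, star_u, evalCircle, lift_us, lift_u, star_star]
  | add a b ha hb => rw [star_add, map_add, map_add, ha, hb, star_add]
  | mul a b ha hb => rw [star_mul, map_mul, map_mul, ha, hb, star_mul]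

noncomputable instance : MeasurableSpace Circle := borel Circle

instance : BorelSpace Circle := ⟨rfl⟩

open MeasureTheory

theorem integrable_evalCircle (μ : Measure Circle) [IsProbabilityMeasure μ] (a : Unc 1) :
    Integrable (fun z => evalCircle z a) μ :=
  (continuous_evalCircle a).integrable_of_hasCompactSupport
    (HasCompactSupport.of_compactSpace _)

/-- The state on `U⟨1⟩` given by a probability measure on the circle, `a ↦ ∫ a(z) dμ(z)`; in
particular `u ^ k ↦ ∫ z ^ k dμ(z)` and `(u*) ^ k ↦ ∫ (conj z) ^ k dμ(z)`. -/
noncomputable def circleState (μ : Measure Circle) [IsProbabilityMeasure μ] : State (Unc 1) where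
  toLin :=
    { toFun := fun a => ∫ z, evalCircle z a ∂μ
      map_add' := fun a b => by
        simp only [map_add]
        exact integral_add (integrable_evalCircle μ a) (integrable_evalCircle μ b)
      map_smul' := fun c a => by
        simp only [map_smul]
        exact integral_smul c _ }
  map_one' := by simp
  nonneg' a := by
    change 0 ≤ ∫ z, evalCircle z (star a * a) ∂μ
    refine integral_nonneg fun z => ?_
    rw [map_mul, evalCircle_star]
    exact star_mul_self_nonneg _

/-- The normalized Haar measure on the circle. -/
noncomputable def circleHaar : Measure Circle := Measure.haarMeasure ⊤

instance : IsProbabilityMeasure circleHaar :=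
  ⟨Measure.haarMeasure_self (K₀ := (⊤ : TopologicalSpace.PositiveCompacts Circle))⟩

end Unc

end UnitaryDual

namespace NCProb

variable {A : Type*} [Ring A] [Algebra ℂ A]

/-! ### Alternating words and the spans of those ending or starting in a given leg -/

/-! On `U⟨1⟩` the algebra is spanned by the powers of `u` and of `u*`, and the Haar measure is the
unital functional that kills all positive powers of both. Since `Δ(uᵏ)` and `Δ((u*)ᵏ)` are
alternating powers `(v⁽¹⁾v⁽²⁾)ᵏ` and `(v⁽²⁾v⁽¹⁾)ᵏ` with `v = u` and `v = u*` respectively,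
absorption reduces to one claim, `IsProduct.apply_pow`: if one of the two functionals kills every
positive power of `v`, where `δ(v) = 1`, then each of the five products kills the alternating powers
of `v`. The boolean and the two monotone cases write single letters as `v = (v - 1) + 1` with `v -
1` in `ker δ`: the summand `v - 1` allows a neighbouring letter to be factored out, and the summand
`1` merges neighbouring powers. The free case does the same with the centring `v = (v - φ(v)) +
φ(v)`, and the tensor case is a computation in `A ⊗ A`. Two Haar states `h`, `h'` agree because `h =
h ⋆ h' = h'`.

For `n ≥ 2` a second moment of a would-be Haar state `h` is computed in two contradictory ways. In
the free, tensor and monotone products, `a⁽¹⁾ b⁽²⁾ a'⁽¹⁾` has the value `φ₁(aa') φ₂(b)`; in the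
anti-monotone product the same holds with the legs exchanged. Let `flipState m` be the vector state
at `eₘ` of the unitary `uᵢⱼ ↦ Eⱼᵢ`. Its second moments reduce the double sum in `(h ⋆ flipState
m)(uᵢᵢ uᵢᵢ*)` to a single sum that unitarity evaluates, giving `1` if `i = m` and `0` otherwise,
whatever `h` is. A Haar state would make this independent of `m`. The anti-monotone case uses `uᵢᵢ*
uᵢᵢ` with the flip on the left.

The boolean product has a different sandwich formula. It gives `(h ⋆ φ)(uᵢᵢ* uᵢᵢ) = φ(uᵢᵢ* uᵢᵢ)`
whenever `φ` vanishes on the `i`-th column of `u`, and two such states with different second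
moments, `flipState j` for `j ≠ i` and `exchangeState`, exclude a Haar state. -/

theorem wordProd_append (w w' : List (Fin 2 × A)) :
    wordProd (w ++ w') = wordProd w * wordProd w' := by
  simp [wordProd]

theorem legLetters_append (i : Fin 2) (w w' : List (Fin 2 × A)) :
    legLetters i (w ++ w') = legLetters i w ++ legLetters i w' := by
  simp [legLetters]

theorem legLetters_nil (i : Fin 2) : legLetters i ([] : List (Fin 2 × A)) = [] := rfl

theorem alternating_append {w w' : List (Fin 2 × A)} :
    Alternating (w ++ w') ↔ Alternating w ∧ Alternating w' ∧
      ∀ x ∈ w.getLast?, ∀ y ∈ w'.head?, x.1 ≠ y.1 :=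
  List.isChain_append

theorem alternating_singleton (x : Fin 2 × A) : Alternating [x] := List.IsChain.singleton _

/-- Alternating words with letters in `ker δ`. -/
def Reduced (δ : A →ₐ[ℂ] ℂ) (w : List (Fin 2 × A)) : Prop :=
  Alternating w ∧ ∀ x ∈ w, δ x.2 = 0

/-- The span of the reduced words that are empty or end in the leg `p`. -/
noncomputable def endSpan (δ : A →ₐ[ℂ] ℂ) (p : Fin 2) : Submodule ℂ (FreeSq A) :=
  Submodule.span ℂ {x | ∃ w, Reduced δ w ∧ (∀ y ∈ w.getLast?, y.1 = p) ∧ x = wordProd w}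

/-- The span of the reduced words that are empty or start in the leg `p`. -/
noncomputable def startSpan (δ : A →ₐ[ℂ] ℂ) (p : Fin 2) : Submodule ℂ (FreeSq A) :=
  Submodule.span ℂ {x | ∃ w, Reduced δ w ∧ (∀ y ∈ w.head?, y.1 = p) ∧ x = wordProd w}

variable {δ : A →ₐ[ℂ] ℂ}

theorem span_reduced (δ : A →ₐ[ℂ] ℂ) :
    Submodule.span ℂ {x | ∃ w, Reduced δ w ∧ x = wordProd w} = ⊤ := by
  simpa only [Reduced, and_assoc, AlgHom.toLinearMap_apply] using
    span_words (fun _ => δ.toLinearMap) (by simp)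

theorem one_mem_endSpan (p : Fin 2) : (1 : FreeSq A) ∈ endSpan δ p :=
  Submodule.subset_span ⟨[], ⟨List.IsChain.nil, by simp⟩, by simp, rfl⟩

theorem one_mem_startSpan (p : Fin 2) : (1 : FreeSq A) ∈ startSpan δ p :=
  Submodule.subset_span ⟨[], ⟨List.IsChain.nil, by simp⟩, by simp, rfl⟩

/-- By linearity `y` is a reduced word. If it ends in the leg `p`, its last letter absorbs `a` and
stays in `ker δ`, because `ker δ` is an ideal; otherwise `a` is a new last letter. -/
theorem mul_leg_mem_endSpan (y : FreeSq A) {p : Fin 2} {a : A} (ha : δ a = 0) :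
    y * leg p a ∈ endSpan δ p := by
  have hy : y ∈ Submodule.span ℂ {x | ∃ w, Reduced δ w ∧ x = wordProd w} := by
    rw [span_reduced]; trivial
  induction hy using Submodule.span_induction with
  | zero => simp
  | add x y _ _ hx hy => rw [add_mul]; exact Submodule.add_mem _ hx hy
  | smul c x _ hx => rw [smul_mul_assoc]; exact Submodule.smul_mem _ c hx
  | mem x hx =>
    obtain ⟨w, ⟨h1, h2⟩, rfl⟩ := hx
    rcases List.eq_nil_or_concat' w with rfl | ⟨t, ⟨j, b⟩, rfl⟩
    · refine Submodule.subset_span ⟨[(p, a)], ⟨alternating_singleton _, by simpa⟩, by simp, ?_⟩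
      simp [wordProd]
    · obtain ⟨h3, -, h4⟩ := alternating_append.1 h1
      by_cases hj : j = p
      · subst hj
        refine Submodule.subset_span ⟨t ++ [(j, b * a)], ⟨?_, ?_⟩, by simp, ?_⟩
        · exact alternating_append.2 ⟨h3, alternating_singleton _, by simpa using h4⟩
        · intro x hx
          rcases List.mem_append.1 hx with hx | hx
          · exact h2 x (List.mem_append_left _ hx)
          · simp only [List.mem_singleton] at hx
            subst hx
            simp [ha]
        · simp [wordProd, mul_assoc]
      · refine Submodule.subset_span ⟨(t ++ [(j, b)]) ++ [(p, a)], ⟨?_, ?_⟩, by simp, ?_⟩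
        · exact alternating_append.2 ⟨h1, alternating_singleton _, by simpa using hj⟩
        · intro x hx
          rcases List.mem_append.1 hx with hx | hx
          · exact h2 x hx
          · simp only [List.mem_singleton] at hx
            subst hx
            exact ha
        · simp [wordProd, mul_assoc]

theorem leg_mul_mem_startSpan (y : FreeSq A) {p : Fin 2} {a : A} (ha : δ a = 0) :
    leg p a * y ∈ startSpan δ p := by
  have hy : y ∈ Submodule.span ℂ {x | ∃ w, Reduced δ w ∧ x = wordProd w} := by
    rw [span_reduced]; trivial
  induction hy using Submodule.span_induction with
  | zero => simp
  | add x y _ _ hx hy => rw [mul_add]; exact Submodule.add_mem _ hx hy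
  | smul c x _ hx => rw [mul_smul_comm]; exact Submodule.smul_mem _ c hx
  | mem x hx =>
    obtain ⟨w, ⟨h1, h2⟩, rfl⟩ := hx
    rcases w with _ | ⟨⟨j, b⟩, t⟩
    · refine Submodule.subset_span ⟨[(p, a)], ⟨alternating_singleton _, by simpa⟩, by simp, ?_⟩
      simp [wordProd]
    · by_cases hj : p = j
      · subst hj
        obtain ⟨-, h3, h4⟩ := alternating_append (w := [(p, b)]) (w' := t).1 h1
        refine Submodule.subset_span ⟨[(p, a * b)] ++ t, ⟨?_, ?_⟩, by simp, ?_⟩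
        · exact alternating_append.2 ⟨alternating_singleton _, h3, by simpa using h4⟩
        · intro x hx
          rcases List.mem_append.1 hx with hx | hx
          · simp only [List.mem_singleton] at hx
            subst hx
            simp [ha]
          · exact h2 x (List.mem_cons_of_mem _ hx)
        · simp [wordProd, mul_assoc]
      · refine Submodule.subset_span ⟨[(p, a)] ++ (j, b) :: t, ⟨?_, ?_⟩, by simp, ?_⟩
        · exact alternating_append.2 ⟨alternating_singleton _, h1, by simpa using hj⟩
        · intro x hx
          rcases List.mem_append.1 hx with hx | hx
          · simp only [List.mem_singleton] at hx
            subst hx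
            exact ha
          · exact h2 x hx
        · simp [wordProd]

theorem leg_eq_add (δ : A →ₐ[ℂ] ℂ) (p : Fin 2) (a : A) :
    leg p a = leg p (a - δ a • 1) + δ a • 1 := by simp

theorem map_sub_smul_one (δ : A →ₐ[ℂ] ℂ) (a : A) : δ (a - δ a • 1) = 0 := by simp

theorem leg_mem_endSpan (p : Fin 2) (a : A) : leg p a ∈ endSpan δ p := by
  rw [leg_eq_add δ, ← one_mul (leg p (a - δ a • 1))]
  exact Submodule.add_mem _ (mul_leg_mem_endSpan 1 (map_sub_smul_one δ a))
    (Submodule.smul_mem _ _ (one_mem_endSpan p))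

theorem leg_mem_startSpan (p : Fin 2) (a : A) : leg p a ∈ startSpan δ p := by
  rw [leg_eq_add δ, ← mul_one (leg p (a - δ a • 1))]
  exact Submodule.add_mem _ (leg_mul_mem_startSpan 1 (map_sub_smul_one δ a))
    (Submodule.smul_mem _ _ (one_mem_startSpan p))

/-! ### Functionals that factor out the letters of one leg -/

/-- `Φ` factors out letters of the leg `q` at either end of a word, next to a letter of the leg `p`
in `ker δ`. -/
structure CutsEnds (δ : A →ₐ[ℂ] ℂ) (ψ : A →ₗ[ℂ] ℂ) (Φ : FreeSq A →ₗ[ℂ] ℂ) (p q : Fin 2) :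
    Prop where
  right : ∀ y ∈ endSpan δ p, ∀ b, Φ (y * leg q b) = Φ y * ψ b
  left : ∀ y ∈ startSpan δ p, ∀ b, Φ (leg q b * y) = ψ b * Φ y

theorem CutsEnds.apply_leg {ψ : A →ₗ[ℂ] ℂ} {Φ : FreeSq A →ₗ[ℂ] ℂ} {p q : Fin 2} (hΦ : Φ 1 = 1)
    (h : CutsEnds δ ψ Φ p q) (b : A) : Φ (leg q b) = ψ b := by
  have := h.right 1 (one_mem_endSpan p) b
  rwa [one_mul, hΦ, one_mul] at this

/-- This is the case where the killed functional belongs to the last leg. The last `v` in the leg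
`p` is `(v - 1) + 1`: next to `v - 1` the final power of `v` splits off and is killed by `ψ`, while
`1` lets two powers in the leg `q` merge. The merging is why the extra exponent `j` is carried
along; `0 < m + j` only excludes the empty word. -/
theorem CutsEnds.apply_pow_mul {ψ : A →ₗ[ℂ] ℂ} {Φ : FreeSq A →ₗ[ℂ] ℂ} {p q : Fin 2} (hΦ : Φ 1 = 1)
    (h : CutsEnds δ ψ Φ p q) {v : A} (hv : δ v = 1) (hψ : ∀ j, 0 < j → ψ (v ^ j) = 0) (m j : ℕ)
    (hmj : 0 < m + j) : Φ ((leg p v * leg q v) ^ m * leg q (v ^ j)) = 0 := by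
  induction m generalizing j with
  | zero => rw [pow_zero, one_mul, h.apply_leg hΦ, hψ j (by omega)]
  | succ m ih =>
    have e : (leg p v * leg q v) ^ (m + 1) * leg q (v ^ j) =
        (leg p v * leg q v) ^ m * leg p (v - δ v • 1) * leg q (v ^ (j + 1)) +
          (leg p v * leg q v) ^ m * leg q (v ^ (j + 1)) := by
      rw [pow_succ _ m, pow_succ' v j, map_mul, hv]
      simp only [one_smul, map_sub, map_one, mul_sub, sub_mul, mul_one, mul_assoc, sub_add_cancel]
    rw [e, map_add, h.right _ (mul_leg_mem_endSpan _ (map_sub_smul_one δ v)), hψ _ j.succ_pos,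
      ih _ (by omega), mul_zero, add_zero]

theorem CutsEnds.apply_mul_pow {ψ : A →ₗ[ℂ] ℂ} {Φ : FreeSq A →ₗ[ℂ] ℂ} {p q : Fin 2} (hΦ : Φ 1 = 1)
    (h : CutsEnds δ ψ Φ p q) {v : A} (hv : δ v = 1) (hψ : ∀ j, 0 < j → ψ (v ^ j) = 0) (m j : ℕ)
    (hmj : 0 < m + j) : Φ (leg q (v ^ j) * (leg q v * leg p v) ^ m) = 0 := by
  induction m generalizing j with
  | zero => rw [pow_zero, mul_one, h.apply_leg hΦ, hψ j (by omega)]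
  | succ m ih =>
    have e : leg q (v ^ j) * (leg q v * leg p v) ^ (m + 1) =
        leg q (v ^ (j + 1)) * (leg p (v - δ v • 1) * (leg q v * leg p v) ^ m) +
          leg q (v ^ (j + 1)) * (leg q v * leg p v) ^ m := by
      rw [pow_succ' _ m, pow_succ v j, map_mul, hv]
      simp only [one_smul, map_sub, map_one, mul_sub, sub_mul, one_mul, mul_assoc, sub_add_cancel]
    rw [e, map_add, h.left _ (leg_mul_mem_startSpan _ (map_sub_smul_one δ v)), hψ _ j.succ_pos,
      ih _ (by omega), zero_mul, add_zero]

/-- `Φ` factors out every letter of the leg `q` between letters of the leg `p` in `ker δ`. -/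
def CutsLeg (δ : A →ₐ[ℂ] ℂ) (ψ : A →ₗ[ℂ] ℂ) (Φ : FreeSq A →ₗ[ℂ] ℂ) (p q : Fin 2) : Prop :=
  ∀ y ∈ endSpan δ p, ∀ b, ∀ z ∈ startSpan δ p, Φ (y * leg q b * z) = ψ b * Φ (y * z)

theorem CutsLeg.cutsEnds {ψ : A →ₗ[ℂ] ℂ} {Φ : FreeSq A →ₗ[ℂ] ℂ} {p q : Fin 2}
    (h : CutsLeg δ ψ Φ p q) : CutsEnds δ ψ Φ p q where
  right y hy b := by simpa [mul_comm] using h y hy b 1 (one_mem_startSpan p)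
  left y hy b := by simpa using h 1 (one_mem_endSpan p) b y hy

/-- Here the killed functional is that of the leg `p`, whose letters are multiplied together rather
than evaluated singly. Splitting the second `v` of the leg `p` as `(v - 1) + 1` either cuts out
`vⁱ`, so that the surrounding powers in the leg `p` merge, or raises `i`. The leading exponent never
falls below `1`, so `φ` kills what is left at the end. -/
theorem CutsLeg.apply_mul_pow {φ ψ : A →ₗ[ℂ] ℂ} {Φ : FreeSq A →ₗ[ℂ] ℂ} {p q : Fin 2}
    (h : CutsLeg δ ψ Φ p q) (hφ : ∀ a, Φ (leg p a) = φ a) {v : A} (hv : δ v = 1)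
    (hv' : ∀ j, 0 < j → φ (v ^ j) = 0) (m i j : ℕ) :
    Φ (leg p (v ^ (j + 1)) * leg q (v ^ i) * (leg p v * leg q v) ^ m) = 0 := by
  induction m generalizing i j with
  | zero =>
    rw [h _ (leg_mem_endSpan _ _) _ _ (by rw [pow_zero]; exact one_mem_startSpan p), pow_zero,
      mul_one, hφ, hv' _ j.succ_pos, mul_zero]
  | succ m ih =>
    have e : leg p (v ^ (j + 1)) * leg q (v ^ i) * (leg p v * leg q v) ^ (m + 1) =
        leg p (v ^ (j + 1)) * leg q (v ^ i) *
            (leg p (v - δ v • 1) * (leg q v * (leg p v * leg q v) ^ m)) +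
          leg p (v ^ (j + 1)) * leg q (v ^ (i + 1)) * (leg p v * leg q v) ^ m := by
      rw [pow_succ' _ m, pow_succ v i, map_mul _ (v ^ i), hv]
      simp only [one_smul, map_sub, map_one, mul_sub, sub_mul, one_mul, mul_assoc, sub_add_cancel]
    -- Once `vⁱ` is cut out, `vʲ⁺¹(v - 1)` is a single letter, and both of its terms have the shape
    -- covered by the induction hypothesis, with middle exponent `1`.
    have e' : leg p (v ^ (j + 1)) * (leg p (v - δ v • 1) * (leg q v * (leg p v * leg q v) ^ m)) =
        leg p (v ^ (j + 1 + 1)) * leg q (v ^ 1) * (leg p v * leg q v) ^ m -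
          leg p (v ^ (j + 1)) * leg q (v ^ 1) * (leg p v * leg q v) ^ m := by
      rw [pow_succ v (j + 1), map_mul _ (v ^ (j + 1)), hv, pow_one]
      simp only [one_smul, map_sub, map_one, mul_sub, sub_mul, one_mul, mul_assoc]
    rw [e, map_add, h _ (leg_mem_endSpan _ _) _ _
      (leg_mul_mem_startSpan _ (map_sub_smul_one δ v)), e', map_sub, ih, ih, ih]
    simp

theorem CutsLeg.apply_pow_mul {φ ψ : A →ₗ[ℂ] ℂ} {Φ : FreeSq A →ₗ[ℂ] ℂ} {p q : Fin 2}
    (h : CutsLeg δ ψ Φ p q) (hφ : ∀ a, Φ (leg p a) = φ a) {v : A} (hv : δ v = 1)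
    (hv' : ∀ j, 0 < j → φ (v ^ j) = 0) (m i j : ℕ) :
    Φ ((leg q v * leg p v) ^ m * leg q (v ^ i) * leg p (v ^ (j + 1))) = 0 := by
  induction m generalizing i j with
  | zero =>
    rw [h _ (by rw [pow_zero]; exact one_mem_endSpan p) _ _ (leg_mem_startSpan _ _), pow_zero,
      one_mul, hφ, hv' _ j.succ_pos, mul_zero]
  | succ m ih =>
    have e : (leg q v * leg p v) ^ (m + 1) * leg q (v ^ i) * leg p (v ^ (j + 1)) =
        (leg q v * leg p v) ^ m * leg q v * leg p (v - δ v • 1) * leg q (v ^ i) *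
            leg p (v ^ (j + 1)) +
          (leg q v * leg p v) ^ m * leg q (v ^ (i + 1)) * leg p (v ^ (j + 1)) := by
      rw [pow_succ _ m, pow_succ' v i, map_mul _ v (v ^ i), hv]
      simp only [one_smul, map_sub, map_one, mul_sub, sub_mul, mul_one, mul_assoc, sub_add_cancel]
    have e' : (leg q v * leg p v) ^ m * leg q v * leg p (v - δ v • 1) * leg p (v ^ (j + 1)) =
        (leg q v * leg p v) ^ m * leg q (v ^ 1) * leg p (v ^ (j + 1 + 1)) -
          (leg q v * leg p v) ^ m * leg q (v ^ 1) * leg p (v ^ (j + 1)) := by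
      rw [pow_succ' v (j + 1), map_mul _ v (v ^ (j + 1)), hv, pow_one]
      simp only [one_smul, map_sub, map_one, mul_sub, sub_mul, mul_one, mul_assoc]
    rw [e, map_add, h _ (mul_leg_mem_endSpan _ (map_sub_smul_one δ v)) _ _
      (leg_mem_startSpan _ _), e', map_sub, ih, ih, ih]
    simp

/-! ### The boolean product -/

/-- For `b` in `ker δ` the extended word is again reduced and contributes one more factor; for
scalar `b` the claim is linearity. The word must end (or start) in the other leg, since otherwise
`b` would merge with its neighbour. -/
theorem IsProduct.boolean_cutsEnds {φ : Fin 2 → A →ₗ[ℂ] ℂ} {Φ : FreeSq A →ₗ[ℂ] ℂ}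
    (hφ : ∀ i, φ i 1 = 1) (h : IsProduct δ φ Φ .boolean) {p q : Fin 2} (hpq : p ≠ q) :
    CutsEnds δ (φ q) Φ p q := by
  have hw : ∀ w, Reduced δ w → Φ (wordProd w) = (w.map fun x => φ x.1 x.2).prod := by
    intro w hw
    by_cases hn : w = []
    · subst hn; rw [wordProd_nil, h.1]; rfl
    · exact h.2 w hn hw.1 hw.2
  constructor
  · intro y hy b
    induction hy using Submodule.span_induction with
    | zero => simp
    | add x y _ _ hx hy => rw [add_mul, map_add, map_add, hx, hy, add_mul]
    | smul c x _ hx => rw [smul_mul_assoc, map_smul, map_smul, hx, smul_mul_assoc]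
    | mem x hx =>
      obtain ⟨w, hr, hl, rfl⟩ := hx
      have hr' : Reduced δ (w ++ [(q, b - δ b • 1)]) := by
        refine ⟨alternating_append.2 ⟨hr.1, alternating_singleton _, ?_⟩, ?_⟩
        · intro x hx y hy
          have : (q, b - δ b • 1) = y := by simpa using hy
          rw [hl x hx, ← this]
          exact hpq
        · intro x hx
          rcases List.mem_append.1 hx with hx | hx
          · exact hr.2 x hx
          · simp only [List.mem_singleton] at hx
            subst hx
            simp
      have e := hw _ hr'
      rw [wordProd_append, List.map_append, List.prod_append, ← hw w hr] at e
      rw [leg_eq_add δ, mul_add, map_add, mul_smul_comm, mul_one, map_smul]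
      have e' : wordProd [(q, b - δ b • 1)] = leg q (b - δ b • 1) := by simp [wordProd]
      rw [e'] at e
      rw [e]
      simp [hφ]
      ring
  · intro y hy b
    induction hy using Submodule.span_induction with
    | zero => simp
    | add x y _ _ hx hy => rw [mul_add, map_add, map_add, hx, hy, mul_add]
    | smul c x _ hx => rw [mul_smul_comm, map_smul, map_smul, hx, mul_smul_comm]
    | mem x hx =>
      obtain ⟨w, hr, hl, rfl⟩ := hx
      have hr' : Reduced δ ([(q, b - δ b • 1)] ++ w) := by
        refine ⟨alternating_append.2 ⟨alternating_singleton _, hr.1, ?_⟩, ?_⟩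
        · intro x hx y hy
          have : (q, b - δ b • 1) = x := by simpa using hx
          rw [hl y hy, ← this]
          exact hpq.symm
        · intro x hx
          rcases List.mem_append.1 hx with hx | hx
          · simp only [List.mem_singleton] at hx
            subst hx
            simp
          · exact hr.2 x hx
      have e := hw _ hr'
      rw [wordProd_append, List.map_append, List.prod_append, ← hw w hr] at e
      rw [leg_eq_add δ, add_mul, map_add, smul_mul_assoc, one_mul, map_smul]
      have e' : wordProd [(q, b - δ b • 1)] = leg q (b - δ b • 1) := by simp [wordProd]
      rw [e'] at e
      rw [e]
      simp [hφ]
      ring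

/-! ### The monotone and the anti-monotone product -/

/-- The product of `φ p` and `φ q` in which the letters of the leg `q` are evaluated one by one. -/
def IsMonotone (δ : A →ₐ[ℂ] ℂ) (φ : Fin 2 → A →ₗ[ℂ] ℂ) (Φ : FreeSq A →ₗ[ℂ] ℂ) (p q : Fin 2) :
    Prop :=
  ∀ w, Reduced δ w →
    Φ (wordProd w) = φ p (legLetters p w).prod * ((legLetters q w).map (φ q)).prod

theorem IsProduct.isMonotone {φ : Fin 2 → A →ₗ[ℂ] ℂ} {Φ : FreeSq A →ₗ[ℂ] ℂ}
    (hφ : ∀ i, φ i 1 = 1) (h : IsProduct δ φ Φ .monotone) : IsMonotone δ φ Φ 0 1 := by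
  intro w hw
  by_cases hn : w = []
  · subst hn; simp [wordProd_nil, h.1, legLetters, hφ]
  · exact h.2 w hn hw.1 hw.2

theorem IsProduct.isMonotone_swap {φ : Fin 2 → A →ₗ[ℂ] ℂ} {Φ : FreeSq A →ₗ[ℂ] ℂ}
    (hφ : ∀ i, φ i 1 = 1) (h : IsProduct δ φ Φ .antimonotone) : IsMonotone δ φ Φ 1 0 := by
  intro w hw
  by_cases hn : w = []
  · subst hn; simp [wordProd_nil, h.1, legLetters, hφ]
  · rw [mul_comm]; exact h.2 w hn hw.1 hw.2

/-- The concatenation is not alternating, as two letters of the leg `p` meet. Merging them into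
their product gives a reduced word with the same product in the leg `p` and the same letters in the
leg `q`. -/
theorem IsMonotone.apply_mul {φ : Fin 2 → A →ₗ[ℂ] ℂ} {Φ : FreeSq A →ₗ[ℂ] ℂ} {p q : Fin 2}
    (hpq : p ≠ q) (h : IsMonotone δ φ Φ p q) {w w' : List (Fin 2 × A)} (hw : Reduced δ w)
    (hw' : Reduced δ w') (hl : ∀ y ∈ w.getLast?, y.1 = p) (hl' : ∀ y ∈ w'.head?, y.1 = p) :
    Φ (wordProd w * wordProd w') = φ p ((legLetters p w).prod * (legLetters p w').prod) *
      (((legLetters q w).map (φ q)).prod * ((legLetters q w').map (φ q)).prod) := by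
  rcases List.eq_nil_or_concat' w with rfl | ⟨t, ⟨i, a⟩, rfl⟩
  · simpa [wordProd_nil, legLetters_nil] using h w' hw'
  rcases w' with _ | ⟨⟨j, b⟩, s⟩
  · simpa [wordProd_nil, legLetters_nil] using h _ hw
  obtain rfl : i = p := hl (i, a) (by simp)
  obtain rfl : j = i := hl' (j, b) (by simp)
  obtain ⟨h1, -, h2⟩ := alternating_append.1 hw.1
  obtain ⟨-, h3, h4⟩ := alternating_append (w := [(j, b)]) (w' := s).1 hw'.1
  have hr : Reduced δ (t ++ (j, a * b) :: s) := by
    refine ⟨alternating_append.2 ⟨h1, alternating_append (w := [(j, a * b)]) (w' := s).2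
      ⟨alternating_singleton _, h3, by simpa using h4⟩, by simpa using h2⟩, ?_⟩
    intro x hx
    rcases List.mem_append.1 hx with hx | hx
    · exact hw.2 x (List.mem_append_left _ hx)
    rcases List.mem_cons.1 hx with rfl | hx
    · simpa using Or.inl (hw.2 (j, a) (by simp))
    · exact hw'.2 x (List.mem_cons_of_mem _ hx)
  have e := h _ hr
  have e' : wordProd (t ++ [(j, a)]) * wordProd ((j, b) :: s) =
      wordProd (t ++ (j, a * b) :: s) := by
    simp [wordProd, mul_assoc]
  rw [e', e]
  simp [legLetters_append, legLetters_cons, legLetters_nil, hpq, mul_assoc]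

/-- Decompose `b = (b - δ(b)) + δ(b)`. The first part is a genuine letter of a reduced word and
contributes `φ q (b) - δ(b)`; the scalar part makes the two words touch, which
`IsMonotone.apply_mul` evaluates with the same remaining factor. -/
theorem IsMonotone.cutsLeg {φ : Fin 2 → A →ₗ[ℂ] ℂ} {Φ : FreeSq A →ₗ[ℂ] ℂ} {p q : Fin 2}
    (hφ : ∀ i, φ i 1 = 1) (hpq : p ≠ q) (h : IsMonotone δ φ Φ p q) :
    CutsLeg δ (φ q) Φ p q := by
  intro y hy b z hz
  induction hy using Submodule.span_induction with
  | zero => simp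
  | add x y _ _ hx hy => simp only [add_mul, map_add, hx, hy, mul_add]
  | smul c x _ hx => simp only [smul_mul_assoc, map_smul, hx, mul_smul_comm]
  | mem x hx =>
    obtain ⟨w, hr, hl, rfl⟩ := hx
    induction hz using Submodule.span_induction with
    | zero => simp
    | add x y _ _ hx hy => simp only [mul_add, map_add, hx, hy]
    | smul c x _ hx => simp only [map_smul, hx, mul_smul_comm]
    | mem x hx =>
      obtain ⟨w', hr', hl', rfl⟩ := hx
      have hm : Reduced δ (w ++ (q, b - δ b • 1) :: w') := by
        refine ⟨alternating_append.2 ⟨hr.1,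
          alternating_append (w := [(q, b - δ b • 1)]) (w' := w').2
            ⟨alternating_singleton _, hr'.1, ?_⟩, ?_⟩, ?_⟩
        · intro x hx y hy
          have : (q, b - δ b • 1) = x := by simpa using hx
          rw [hl' y hy, ← this]
          exact hpq.symm
        · intro x hx y hy
          have : (q, b - δ b • 1) = y := by simpa using hy
          rw [hl x hx, ← this]
          exact hpq
        · intro x hx
          rcases List.mem_append.1 hx with hx | hx
          · exact hr.2 x hx
          rcases List.mem_cons.1 hx with rfl | hx
          · simp
          · exact hr'.2 x hx
      have e := h _ hm
      rw [wordProd_append, wordProd_cons, ← mul_assoc] at e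
      rw [leg_eq_add δ, mul_add, add_mul, map_add, mul_smul_comm, mul_one, smul_mul_assoc,
        map_smul, e, h.apply_mul hpq hr hr' hl hl']
      simp [legLetters_append, legLetters_cons, hpq.symm, hφ]
      ring

/-! ### The tensor product -/

/-- The homomorphism `A ⊔ A → A ⊗ A` that makes the legs commute. -/
noncomputable def toTensor : FreeSq A →ₐ[ℂ] A ⊗[ℂ] A :=
  LinearAlgebra.FreeProduct.lift ℂ (fun _ : Fin 2 => A) (fun {i} =>
    (![Algebra.TensorProduct.includeLeft, Algebra.TensorProduct.includeRight] :
      Fin 2 → A →ₐ[ℂ] A ⊗[ℂ] A) i)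

theorem toTensor_leg (i : Fin 2) (a : A) :
    toTensor (leg i a) = (![Algebra.TensorProduct.includeLeft,
      Algebra.TensorProduct.includeRight] : Fin 2 → A →ₐ[ℂ] A ⊗[ℂ] A) i a :=
  DFunLike.congr_fun (LinearAlgebra.FreeProduct.lift_comp_ι ℂ (fun _ : Fin 2 => A) (i := i)
    (fun {i} => (![Algebra.TensorProduct.includeLeft, Algebra.TensorProduct.includeRight] :
      Fin 2 → A →ₐ[ℂ] A ⊗[ℂ] A) i)) a

theorem toTensor_leg_zero (a : A) : toTensor (leg 0 a) = a ⊗ₜ 1 := toTensor_leg 0 a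

theorem toTensor_leg_one (a : A) : toTensor (leg 1 a) = 1 ⊗ₜ a := toTensor_leg 1 a

theorem toTensor_wordProd (w : List (Fin 2 × A)) :
    toTensor (wordProd w) = (legLetters 0 w).prod ⊗ₜ (legLetters 1 w).prod := by
  induction w with
  | nil => rw [wordProd_nil, map_one]; rfl
  | cons x t ih =>
    obtain ⟨i, a⟩ := x
    rw [wordProd_cons, map_mul, ih]
    fin_cases i
    · simp [toTensor_leg_zero, legLetters_cons]
    · simp [toTensor_leg_one, legLetters_cons]

/-- The right-hand side satisfies the defining formula on all words, not only on reduced ones, so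
uniqueness of the product applies. -/
theorem IsProduct.tensor_eq {φ : Fin 2 → A →ₗ[ℂ] ℂ} {Φ : FreeSq A →ₗ[ℂ] ℂ}
    (hφ : ∀ i, φ i 1 = 1) (h : IsProduct δ φ Φ .tensor) :
    Φ = tensorFun φ ∘ₗ toTensor.toLinearMap := by
  refine h.unique hφ ⟨?_, ?_⟩
  · simp [Algebra.TensorProduct.one_def, tensorFun_tmul, hφ]
  · intro w _ _ _
    simp [toTensor_wordProd, tensorFun_tmul]

/-! ### The free product -/

/-- Positive powers of `v` in the leg `p` are already centred, so only letters of the leg `q` need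
centring. Centring the first of them either lengthens the centred prefix `w`, or replaces the letter
by a scalar and merges two powers of `v` into a higher one. Both cases shorten the uncentred tail.
-/
theorem IsProduct.free_apply_pow {φ : Fin 2 → A →ₗ[ℂ] ℂ} {Φ : FreeSq A →ₗ[ℂ] ℂ}
    (hφ : ∀ i, φ i 1 = 1) (h : IsProduct δ φ Φ .free) {p q : Fin 2} (hpq : p ≠ q) {v : A}
    (hv : ∀ j, 0 < j → φ p (v ^ j) = 0) (m j : ℕ) (w : List (Fin 2 × A)) (hw : Alternating w)
    (hl : ∀ x ∈ w.getLast?, x.1 = q) (hw0 : ∀ x ∈ w, φ x.1 x.2 = 0) (c : A) :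
    Φ (wordProd w * leg p (v ^ (j + 1)) * (leg q v * leg p v) ^ m * leg q c) = 0 := by
  have hp : ∀ (w : List (Fin 2 × A)) (j : ℕ), Alternating w → (∀ x ∈ w.getLast?, x.1 = q) →
      (∀ x ∈ w, φ x.1 x.2 = 0) → Alternating (w ++ [(p, v ^ (j + 1))]) ∧
        ∀ x ∈ w ++ [(p, v ^ (j + 1))], φ x.1 x.2 = 0 := by
    intro w j hw hl hw0
    refine ⟨alternating_append.2 ⟨hw, alternating_singleton _, ?_⟩, ?_⟩
    · intro x hx y hy
      have : (p, v ^ (j + 1)) = y := by simpa using hy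
      rw [hl x hx, ← this]
      exact hpq.symm
    · intro x hx
      rcases List.mem_append.1 hx with hx | hx
      · exact hw0 x hx
      · simp only [List.mem_singleton] at hx
        subst hx
        exact hv _ j.succ_pos
  have hq : ∀ (w : List (Fin 2 × A)) (j : ℕ) (c : A), Alternating w →
      (∀ x ∈ w.getLast?, x.1 = q) → (∀ x ∈ w, φ x.1 x.2 = 0) →
      Alternating (w ++ [(p, v ^ (j + 1))] ++ [(q, c - φ q c • 1)]) ∧
        ∀ x ∈ w ++ [(p, v ^ (j + 1))] ++ [(q, c - φ q c • 1)], φ x.1 x.2 = 0 := by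
    intro w j c hw hl hw0
    refine ⟨alternating_append.2 ⟨(hp w j hw hl hw0).1, alternating_singleton _, ?_⟩, ?_⟩
    · simpa using hpq
    · intro x hx
      rcases List.mem_append.1 hx with hx | hx
      · exact (hp w j hw hl hw0).2 x hx
      · simp only [List.mem_singleton] at hx
        subst hx
        simp [hφ]
  have hone : ∀ (i : Fin 2) (a : A), wordProd [(i, a)] = leg i a := by simp [wordProd]
  have hc : ∀ c : A, leg q c = leg q (c - φ q c • 1) + φ q c • 1 := by simp
  induction m generalizing j w with
  | zero =>
    have h1 := h.2 _ (by simp) (hp w j hw hl hw0).1 (hp w j hw hl hw0).2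
    have h2 := h.2 _ (by simp) (hq w j c hw hl hw0).1 (hq w j c hw hl hw0).2
    rw [wordProd_append, hone] at h1
    rw [wordProd_append, wordProd_append, hone, hone] at h2
    rw [pow_zero, mul_one, hc, mul_add, map_add, h2, mul_smul_comm, mul_one, map_smul, h1]
    simp
  | succ m ih =>
    have h2 := ih 0 _ (hq w j v hw hl hw0).1 (by simp) (hq w j v hw hl hw0).2
    have h1 := ih (j + 1) w hw hl hw0
    rw [wordProd_append, wordProd_append, hone, hone, zero_add, pow_one] at h2
    have e : wordProd w * leg p (v ^ (j + 1)) * (leg q v * leg p v) ^ (m + 1) * leg q c =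
        wordProd w * leg p (v ^ (j + 1)) * leg q (v - φ q v • 1) * leg p v *
            (leg q v * leg p v) ^ m * leg q c +
          φ q v • (wordProd w * leg p (v ^ (j + 1 + 1)) * (leg q v * leg p v) ^ m * leg q c) := by
      rw [pow_succ' _ m, pow_succ v (j + 1), map_mul _ (v ^ (j + 1))]
      simp only [map_sub, map_smul, map_one, mul_sub, sub_mul, mul_one, mul_assoc,
        mul_smul_comm, smul_mul_assoc, sub_add_cancel]
    rw [e, map_add, map_smul, h2, h1]
    simp

/-- After centring all three letters, every term that contains the centred part of `b` is a multiple
of a centred alternating word and vanishes. What survives is `φ q b` times the merged letter `ac`.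
-/
theorem IsProduct.free_apply_sandwich {φ : Fin 2 → A →ₗ[ℂ] ℂ} {Φ : FreeSq A →ₗ[ℂ] ℂ}
    (hφ : ∀ i, φ i 1 = 1) (h : IsProduct δ φ Φ .free) {p q : Fin 2} (hpq : p ≠ q) (a b c : A) :
    Φ (leg p a * leg q b * leg p c) = φ p (a * c) * φ q b := by
  have hone : ∀ (i : Fin 2) (a : A), φ i a = 0 → Φ (leg i a) = 0 := by
    intro i a ha
    simpa [wordProd] using h.2 [(i, a)] (by simp) (alternating_singleton _) (by simpa)
  have hleg : ∀ (i : Fin 2) (a : A), Φ (leg i a) = φ i a := by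
    intro i a
    have := hone i (a - φ i a • 1) (by simp [hφ])
    rw [map_sub, map_smul, map_one, map_sub, map_smul, h.1, smul_eq_mul, mul_one] at this
    exact sub_eq_zero.1 this
  set b' := b - φ q b • 1 with hb'
  have hb : φ q b' = 0 := by simp [hb', hφ]
  set a' := a - φ p a • 1 with ha'
  have ha : φ p a' = 0 := by simp [ha', hφ]
  set c' := c - φ p c • 1 with hc'
  have hc : φ p c' = 0 := by simp [hc', hφ]
  have e1 : Φ (leg p a' * leg q b' * leg p c') = 0 := by
    have := h.2 [(p, a'), (q, b'), (p, c')] (by simp)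
      (by simp [Alternating, hpq, hpq.symm]) (by simp [ha, hb, hc])
    simpa [wordProd, mul_assoc] using this
  have e2 : Φ (leg p a' * leg q b') = 0 := by
    have := h.2 [(p, a'), (q, b')] (by simp) (by simp [Alternating, hpq]) (by simp [ha, hb])
    simpa [wordProd] using this
  have e3 : Φ (leg q b' * leg p c') = 0 := by
    have := h.2 [(q, b'), (p, c')] (by simp) (by simp [Alternating, hpq.symm]) (by simp [hb, hc])
    simpa [wordProd] using this
  have e : leg p a * leg q b * leg p c = leg p a' * leg q b' * leg p c' +
      φ p a • (leg q b' * leg p c') + φ p c • (leg p a' * leg q b') +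
      (φ p a * φ p c) • leg q b' + φ q b • leg p (a * c) := by
    have e1 : leg p a = leg p a' + φ p a • 1 := by simp [ha']
    have e2 : leg q b = leg q b' + φ q b • 1 := by simp [hb']
    have e3 : leg p c = leg p c' + φ p c • 1 := by simp [hc']
    rw [map_mul, e2, e1, e3]
    simp only [add_mul, mul_add, mul_smul_comm, smul_mul_assoc, mul_one, one_mul, smul_smul,
      smul_add, mul_assoc]
    module
  rw [e]
  simp only [map_add, map_smul, e1, e2, e3, hone q b' hb, hleg]
  simp [mul_comm]

/-! ### Alternating powers -/

theorem IsMonotone.apply_leg {φ : Fin 2 → A →ₗ[ℂ] ℂ} {Φ : FreeSq A →ₗ[ℂ] ℂ} {p q : Fin 2}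
    (hφ : ∀ i, φ i 1 = 1) (hpq : p ≠ q) (h : IsMonotone δ φ Φ p q) (a : A) :
    Φ (leg p a) = φ p a := by
  have h0 := h [] ⟨List.IsChain.nil, by simp⟩
  have h1 := h [(p, a - δ a • 1)] ⟨alternating_singleton _, by simp⟩
  simp only [wordProd_nil, wordProd_cons, legLetters_cons, legLetters_nil, hpq, if_true, if_false,
    List.map_nil, List.prod_nil, List.prod_cons, mul_one, hφ] at h0 h1
  rw [leg_eq_add δ, map_add, h1, map_smul, h0]
  simp [hφ]

theorem IsMonotone.map_one {φ : Fin 2 → A →ₗ[ℂ] ℂ} {Φ : FreeSq A →ₗ[ℂ] ℂ} {p q : Fin 2}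
    (hφ : ∀ i, φ i 1 = 1) (h : IsMonotone δ φ Φ p q) : Φ 1 = 1 := by
  simpa [wordProd_nil, legLetters_nil, hφ] using h [] ⟨List.IsChain.nil, by simp⟩

theorem IsMonotone.apply_pow {φ : Fin 2 → A →ₗ[ℂ] ℂ} {Φ : FreeSq A →ₗ[ℂ] ℂ} {p q : Fin 2}
    (hφ : ∀ i, φ i 1 = 1) (hpq : p ≠ q) (h : IsMonotone δ φ Φ p q) {v : A} (hv : δ v = 1)
    {r : Fin 2} (hr : r = p ∨ r = q) (hv' : ∀ j, 0 < j → φ r (v ^ j) = 0) (m : ℕ) :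
    Φ ((leg p v * leg q v) ^ (m + 1)) = 0 ∧ Φ ((leg q v * leg p v) ^ (m + 1)) = 0 := by
  have hc := h.cutsLeg hφ hpq
  rcases hr with rfl | rfl
  · constructor
    · have := hc.apply_mul_pow (h.apply_leg hφ hpq) hv hv' m 1 0
      rwa [zero_add, pow_one, ← pow_succ'] at this
    · have := hc.apply_pow_mul (h.apply_leg hφ hpq) hv hv' m 1 0
      rwa [zero_add, pow_one, mul_assoc, ← pow_succ] at this
  · constructor
    · simpa using hc.cutsEnds.apply_pow_mul (h.map_one hφ) hv hv' (m + 1) 0 (by omega)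
    · simpa using hc.cutsEnds.apply_mul_pow (h.map_one hφ) hv hv' (m + 1) 0 (by omega)

/-- If one of the functionals kills the powers of `v`, so does each of the products for the
alternating powers of `v`. -/
theorem IsProduct.apply_pow {φ : Fin 2 → A →ₗ[ℂ] ℂ} {Φ : FreeSq A →ₗ[ℂ] ℂ}
    (hφ : ∀ i, φ i 1 = 1) {c : Independence} (h : IsProduct δ φ Φ c) {v : A} (hv : δ v = 1)
    {p q r : Fin 2} (hpq : p ≠ q) (hv' : ∀ j, 0 < j → φ r (v ^ j) = 0) (m : ℕ) :
    Φ ((leg p v * leg q v) ^ (m + 1)) = 0 := by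
  have hr : r = p ∨ r = q := by omega
  cases c with
  | free =>
    rcases hr with rfl | rfl
    · have := h.free_apply_pow hφ hpq hv' m 0 [] List.IsChain.nil (by simp) (by simp) v
      rwa [wordProd_nil, one_mul, zero_add, pow_one, ← mul_pow_mul, mul_assoc, ← pow_succ] at this
    -- The word starts in the leg whose powers are not assumed to be killed. Its first letter is
    -- centred: the centred part serves as the prefix `w`, the scalar part leaves an empty prefix.
    · have h1 := h.free_apply_pow hφ hpq.symm hv' m 0 [] List.IsChain.nil (by simp) (by simp) 1
      have h2 := h.free_apply_pow hφ hpq.symm hv' m 0 [(p, v - φ p v • 1)]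
        (alternating_singleton _) (by simp) (by simp [hφ]) 1
      rw [wordProd_nil, one_mul, zero_add, pow_one, _root_.map_one, mul_one] at h1
      rw [wordProd_cons, wordProd_nil, mul_one, zero_add, pow_one, _root_.map_one, mul_one] at h2
      have e : (leg p v * leg r v) ^ (m + 1) =
          leg p (v - φ p v • 1) * leg r v * (leg p v * leg r v) ^ m +
            φ p v • (leg r v * (leg p v * leg r v) ^ m) := by
        rw [pow_succ']
        simp [sub_mul]
      rw [e, map_add, map_smul, h2, h1]
      simp
  | tensor =>
    have e : toTensor ((leg p v * leg q v) ^ (m + 1)) = (v ^ (m + 1)) ⊗ₜ[ℂ] (v ^ (m + 1)) := by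
      fin_cases p <;> fin_cases q
      · exact absurd rfl hpq
      · simp [toTensor_leg_zero, toTensor_leg_one, Algebra.TensorProduct.tmul_pow]
      · simp [toTensor_leg_zero, toTensor_leg_one, Algebra.TensorProduct.tmul_pow]
      · exact absurd rfl hpq
    rw [h.tensor_eq hφ, LinearMap.comp_apply, AlgHom.toLinearMap_apply, e, tensorFun_tmul]
    fin_cases r
    · exact mul_eq_zero_of_left (hv' _ m.succ_pos) _
    · exact mul_eq_zero_of_right _ (hv' _ m.succ_pos)
  | boolean =>
    -- The killed functional belongs to the first or to the last letter of the alternating power;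
    -- letters are cut off at that end.
    rcases hr with rfl | rfl
    · simpa using (h.boolean_cutsEnds hφ hpq.symm).apply_mul_pow h.1 hv hv' (m + 1) 0 (by omega)
    · simpa using (h.boolean_cutsEnds hφ hpq).apply_pow_mul h.1 hv hv' (m + 1) 0 (by omega)
  | monotone =>
    have := (h.isMonotone hφ).apply_pow hφ (by simp) hv (r := r) (by omega) hv' m
    fin_cases p <;> fin_cases q
    · exact absurd rfl hpq
    · exact this.1
    · exact this.2
    · exact absurd rfl hpq
  | antimonotone =>
    have := (h.isMonotone_swap hφ).apply_pow hφ (by simp) hv (r := r) (by omega) hv' m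
    fin_cases p <;> fin_cases q
    · exact absurd rfl hpq
    · exact this.2
    · exact this.1
    · exact absurd rfl hpq

/-! ### Sandwiched letters -/

theorem IsMonotone.apply_sandwich {φ : Fin 2 → A →ₗ[ℂ] ℂ} {Φ : FreeSq A →ₗ[ℂ] ℂ} {p q : Fin 2}
    (hφ : ∀ i, φ i 1 = 1) (hpq : p ≠ q) (h : IsMonotone δ φ Φ p q) (a b a' : A) :
    Φ (leg p a * leg q b * leg p a') = φ p (a * a') * φ q b := by
  rw [h.cutsLeg hφ hpq _ (leg_mem_endSpan p a) b _ (leg_mem_startSpan p a'), ← map_mul,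
    h.apply_leg hφ hpq, mul_comm]

theorem IsProduct.tensor_apply_sandwich {φ : Fin 2 → A →ₗ[ℂ] ℂ} {Φ : FreeSq A →ₗ[ℂ] ℂ}
    (hφ : ∀ i, φ i 1 = 1) (h : IsProduct δ φ Φ .tensor) (a b a' : A) :
    Φ (leg 0 a * leg 1 b * leg 0 a') = φ 0 (a * a') * φ 1 b := by
  rw [h.tensor_eq hφ]
  simp [toTensor_leg_zero, toTensor_leg_one, tensorFun_tmul]

/-- The part of `a` in `ker δ` separates `b` from `b'`, so they are evaluated one by one; the scalar
part `δ(a)` lets them merge. This is where the dependence on `δ` becomes visible. -/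
theorem IsProduct.boolean_apply_sandwich {φ : Fin 2 → A →ₗ[ℂ] ℂ} {Φ : FreeSq A →ₗ[ℂ] ℂ}
    (hφ : ∀ i, φ i 1 = 1) (h : IsProduct δ φ Φ .boolean) {p q : Fin 2} (hpq : p ≠ q)
    (b a b' : A) :
    Φ (leg q b * leg p a * leg q b') =
      δ a * φ q (b * b') + (φ p a - δ a) * (φ q b * φ q b') := by
  have hc := h.boolean_cutsEnds hφ hpq
  have e : leg q b * leg p a * leg q b' =
      leg q b * (leg p (a - δ a • 1) * leg q b') + δ a • leg q (b * b') := by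
    simp [sub_mul, mul_sub, mul_assoc]
  rw [e, map_add, hc.left _ (leg_mul_mem_startSpan _ (map_sub_smul_one δ a)),
    hc.right _ (leg_mem_endSpan p _), map_smul, hc.apply_leg h.1,
    (h.boolean_cutsEnds hφ hpq.symm).apply_leg h.1]
  simp [hφ]
  ring

end NCProb

namespace UnitaryDual

open NCProb

namespace Unc

variable {n : ℕ}

/-! ### The structure maps of `U⟨n⟩` on generators. -/

theorem prodState_weights (φ ψ : State (Unc n)) (i : Fin 2) :
    (![φ.toLin, ψ.toLin] : Fin 2 → Unc n →ₗ[ℂ] ℂ) i 1 = 1 := by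
  fin_cases i
  · exact φ.map_one'
  · exact ψ.map_one'

theorem convolution_apply (c : Independence) (φ ψ : State (Unc n)) (a : Unc n) :
    convolution c φ ψ a = prodState c (counit n) φ ψ (coproduct n a) := rfl

theorem coproduct_u (i j : Fin n) :
    coproduct n (u i j) = ∑ k, leg 0 (u i k) * leg 1 (u k j) := lift_u _ _ _ _ i j

theorem coproduct_us (i j : Fin n) :
    coproduct n (us i j) = ∑ k, leg 1 (us k j) * leg 0 (us i k) := by
  refine (lift_us _ _ _ _ i j).trans ?_
  simp only [star_u]

theorem counit_u (i j : Fin n) : counit n (u i j) = if i = j then 1 else 0 := lift_u _ _ _ _ i j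

theorem counit_us (i j : Fin n) : counit n (us i j) = if i = j then 1 else 0 := lift_us _ _ _ _ i j

/-! ### The circle -/

theorem us_mul_u_zero : us (0 : Fin 1) 0 * u 0 0 = 1 := by
  simpa using sum_us_mul_u (0 : Fin 1) 0

theorem u_mul_us_zero : u (0 : Fin 1) 0 * us 0 0 = 1 := by
  simpa using sum_u_mul_us (0 : Fin 1) 0

/-- As `u` and `u*` are mutually inverse, left multiplication by either one preserves the span of
the powers. -/
theorem span_powers :
    Submodule.span ℂ ({x | ∃ k, x = u (0 : Fin 1) 0 ^ k} ∪ {x | ∃ k, x = us (0 : Fin 1) 0 ^ k}) =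
      ⊤ := by
  set T := Submodule.span ℂ
    ({x | ∃ k, x = u (0 : Fin 1) 0 ^ k} ∪ {x | ∃ k, x = us (0 : Fin 1) 0 ^ k}) with hT
  have hu : ∀ k, u (0 : Fin 1) 0 ^ k ∈ T := fun k => Submodule.subset_span (Or.inl ⟨k, rfl⟩)
  have hus : ∀ k, us (0 : Fin 1) 0 ^ k ∈ T := fun k => Submodule.subset_span (Or.inr ⟨k, rfl⟩)
  have h1 : ∀ y ∈ T, u (0 : Fin 1) 0 * y ∈ T := by
    intro y hy
    induction hy using Submodule.span_induction with
    | zero => simp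
    | add x y _ _ hx hy => rw [mul_add]; exact T.add_mem hx hy
    | smul c x _ hx => rw [mul_smul_comm]; exact T.smul_mem c hx
    | mem x hx =>
      rcases hx with ⟨k, rfl⟩ | ⟨k, rfl⟩
      · rw [← pow_succ']; exact hu _
      · cases k with
        | zero => simpa using hu 1
        | succ k => rw [pow_succ', ← mul_assoc, u_mul_us_zero, one_mul]; exact hus k
  have h2 : ∀ y ∈ T, us (0 : Fin 1) 0 * y ∈ T := by
    intro y hy
    induction hy using Submodule.span_induction with
    | zero => simp
    | add x y _ _ hx hy => rw [mul_add]; exact T.add_mem hx hy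
    | smul c x _ hx => rw [mul_smul_comm]; exact T.smul_mem c hx
    | mem x hx =>
      rcases hx with ⟨k, rfl⟩ | ⟨k, rfl⟩
      · cases k with
        | zero => simpa using hus 1
        | succ k => rw [pow_succ', ← mul_assoc, us_mul_u_zero, one_mul]; exact hu k
      · rw [← pow_succ']; exact hus _
  rw [eq_top_iff]
  rintro x -
  suffices h : ∀ y ∈ T, x * y ∈ T by simpa using h 1 (by simpa using hu 0)
  induction x using induction with
  | scalar c => intro y hy; rw [← Algebra.smul_def]; exact T.smul_mem c hy
  | gen i j => rw [Subsingleton.elim i 0, Subsingleton.elim j 0]; exact h1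
  | gen_star i j => rw [Subsingleton.elim i 0, Subsingleton.elim j 0]; exact h2
  | add a b ha hb => intro y hy; rw [add_mul]; exact T.add_mem (ha y hy) (hb y hy)
  | mul a b ha hb => intro y hy; rw [mul_assoc]; exact ha _ (hb y hy)

open MeasureTheory

/-! ### The Haar measure on the circle absorbs all states, and uniqueness. -/

instance : circleHaar.IsMulLeftInvariant := by
  unfold circleHaar; infer_instance

/-- Rotation by `exp(iπ/k)` preserves the measure and changes the sign of `zᵏ`, so the integral
equals its own negative. -/
theorem integral_pow_circleHaar {k : ℕ} (hk : 0 < k) :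
    ∫ z : Circle, (z : ℂ) ^ k ∂circleHaar = 0 := by
  have hI := integral_mul_left_eq_self (μ := circleHaar) (fun z : Circle => (z : ℂ) ^ k)
    (Circle.exp (Real.pi / k))
  have hexp : (Circle.exp (Real.pi / k) : ℂ) ^ k = -1 := by
    have hk' : (k : ℂ) ≠ 0 := by exact_mod_cast hk.ne'
    rw [Circle.coe_exp, ← Complex.exp_nat_mul, ← Complex.exp_pi_mul_I]
    congr 1
    push_cast
    field_simp
  simp only [Circle.coe_mul, mul_pow, hexp] at hI
  rw [integral_const_mul] at hI
  linear_combination (-1 / 2 : ℂ) * hI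

theorem circleState_apply (a : Unc 1) :
    (circleState circleHaar).toLin a = ∫ z, evalCircle z a ∂circleHaar := rfl

theorem circleState_u_pow {k : ℕ} (hk : 0 < k) :
    (circleState circleHaar).toLin (u 0 0 ^ k) = 0 := by
  rw [circleState_apply]
  simp only [map_pow, evalCircle, lift_u]
  exact integral_pow_circleHaar hk

theorem circleState_us_pow {k : ℕ} (hk : 0 < k) :
    (circleState circleHaar).toLin (us 0 0 ^ k) = 0 := by
  rw [circleState_apply]
  simp only [map_pow, evalCircle, lift_us]
  have := congrArg (starRingEnd ℂ) (integral_pow_circleHaar hk)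
  rw [← integral_conj, map_zero] at this
  simpa using this

/-- The index `r` records which factor is the Haar measure, so left and right absorption are treated
together. The adjoint powers use the opposite order of the legs, since `Δ(u*) = u*⁽²⁾u*⁽¹⁾`. -/
theorem convolution_eq_circleState (c : Independence) (φ ψ : State (Unc 1)) (r : Fin 2)
    (hr : (![φ.toLin, ψ.toLin] : Fin 2 → Unc 1 →ₗ[ℂ] ℂ) r = (circleState circleHaar).toLin) :
    convolution c φ ψ = (circleState circleHaar).toLin := by
  have hspec := prodState_spec c (counit 1) φ ψ
  have hone : prodState c (counit 1) φ ψ 1 = 1 := by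
    cases c <;> exact hspec.1
  refine LinearMap.ext_on span_powers ?_
  rintro x (⟨k, rfl⟩ | ⟨k, rfl⟩)
  · cases k with
    | zero => rw [pow_zero, (circleState circleHaar).map_one', convolution_apply, map_one, hone]
    | succ m =>
      rw [circleState_u_pow m.succ_pos, convolution_apply, map_pow, coproduct_u,
        Fin.sum_univ_one]
      exact hspec.apply_pow (prodState_weights φ ψ) (by simp [counit_u]) (r := r) (by simp)
        (fun j hj => by rw [hr, circleState_u_pow hj]) m
  · cases k with
    | zero => rw [pow_zero, (circleState circleHaar).map_one', convolution_apply, map_one, hone]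
    | succ m =>
      rw [circleState_us_pow m.succ_pos, convolution_apply, map_pow, coproduct_us,
        Fin.sum_univ_one]
      exact hspec.apply_pow (prodState_weights φ ψ) (by simp [counit_us]) (r := r) (by simp)
        (fun j hj => by rw [hr, circleState_us_pow hj]) m

theorem isHaarState_circleHaar (c : Independence) : IsHaarState c (circleState circleHaar) :=
  fun φ => ⟨convolution_eq_circleState c φ _ 1 rfl, convolution_eq_circleState c _ φ 0 rfl⟩

theorem state_ext {A : Type*} [Ring A] [StarRing A] [Algebra ℂ A] {φ ψ : State A}
    (h : φ.toLin = ψ.toLin) : φ = ψ := by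
  cases φ; cases ψ; cases h; rfl

theorem IsHaarState.eq {c : Independence} {h h' : State (Unc n)} (hh : IsHaarState c h)
    (hh' : IsHaarState c h') : h = h' :=
  state_ext ((hh h').2.symm.trans (hh' h).1)

/-! ### Vector states of matrix representations -/

theorem lift_star {B : Type*} [Ring B] [StarRing B] [Algebra ℂ B] [StarModule ℂ B]
    (v : Fin n → Fin n → B)
    (h₁ : ∀ i j, ∑ k, star (v k i) * v k j = if i = j then 1 else 0)
    (h₂ : ∀ i j, ∑ k, v i k * star (v j k) = if i = j then 1 else 0) (a : Unc n) :
    lift v (fun i j => star (v i j)) h₁ h₂ (star a) =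
      star (lift v (fun i j => star (v i j)) h₁ h₂ a) := by
  induction a using induction with
  | scalar c =>
    rw [show star (algebraMap ℂ (Unc n) c) = algebraMap ℂ (Unc n) (star c) from
      starFun_algebraMap c, AlgHom.commutes, AlgHom.commutes, algebraMap_star_comm]
  | gen i j => rw [star_u, lift_us, lift_u]
  | gen_star i j => rw [← star_u, star_star, star_u, lift_us, lift_u, star_star]
  | add a b ha hb => rw [star_add, map_add, map_add, ha, hb, star_add]
  | mul a b ha hb => rw [star_mul, map_mul, map_mul, ha, hb, star_mul]

/-- The state `a ↦ ⟨a eᵣ, eᵣ⟩` given by a unitary matrix with entries in `M_d(ℂ)`. -/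
noncomputable def vectorState {d : ℕ} (v : Fin n → Fin n → Matrix (Fin d) (Fin d) ℂ)
    (h₁ : ∀ i j, ∑ k, star (v k i) * v k j = if i = j then 1 else 0)
    (h₂ : ∀ i j, ∑ k, v i k * star (v j k) = if i = j then 1 else 0) (r : Fin d) :
    State (Unc n) where
  toLin := Matrix.entryLinearMap ℂ ℂ r r ∘ₗ (lift v (fun i j => star (v i j)) h₁ h₂).toLinearMap
  map_one' := by simp
  nonneg' a := by
    simp only [LinearMap.comp_apply, AlgHom.toLinearMap_apply, map_mul, lift_star,
      Matrix.entryLinearMap_apply, Matrix.mul_apply, Matrix.star_apply]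
    exact Finset.sum_nonneg fun k _ => star_mul_self_nonneg _

/-- The vector state at `eₘ` of the flip `uᵢⱼ ↦ Eⱼᵢ`. -/
noncomputable def flipState (m : Fin n) : State (Unc n) :=
  vectorState (fun i j => Matrix.single j i 1)
    (by
      intro i j
      split_ifs with h
      · subst h
        simp [Matrix.star_eq_conjTranspose, Matrix.sum_single_one]
      · simp [Matrix.star_eq_conjTranspose, h])
    (by
      intro i j
      split_ifs with h
      · subst h
        simp [Matrix.star_eq_conjTranspose, Matrix.sum_single_one]
      · simp [Matrix.star_eq_conjTranspose, h]) m

theorem flipState_u (m i j : Fin n) :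
    (flipState m).toLin (u i j) = if j = m ∧ i = m then 1 else 0 := by
  simp [flipState, vectorState, lift_u, Matrix.single_apply]

/-- The product is `Eⱼᵢ Eₖₗ = δᵢₖ Eⱼₗ`. Equality of the row indices of `u` is what later reduces a
double sum to its diagonal. -/
theorem flipState_u_mul_us (m i j k l : Fin n) :
    (flipState m).toLin (u i j * us k l) = if i = k ∧ j = m ∧ l = m then 1 else 0 := by
  by_cases h : i = k
  · subst h
    simp [flipState, vectorState, lift_u, lift_us, Matrix.star_eq_conjTranspose,
      Matrix.single_apply]
  · simp [flipState, vectorState, lift_u, lift_us, Matrix.star_eq_conjTranspose, h]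

theorem flipState_us_mul_u (m i j k l : Fin n) :
    (flipState m).toLin (us i j * u k l) = if j = l ∧ i = m ∧ k = m then 1 else 0 := by
  by_cases h : j = l
  · subst h
    simp [flipState, vectorState, lift_u, lift_us, Matrix.star_eq_conjTranspose,
      Matrix.single_apply]
  · simp [flipState, vectorState, lift_u, lift_us, Matrix.star_eq_conjTranspose, h]

/-- A vector state of `uᵢⱼ ↦ δᵢⱼ x`, with `x` the exchange matrix of size two. -/
noncomputable def exchangeState (n : ℕ) : State (Unc n) :=
  vectorState (fun i j => if i = j then !![0, 1; 1, 0] else 0)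
    (by
      intro i j
      have : (star !![0, 1; 1, 0] * !![0, 1; 1, 0] : Matrix (Fin 2) (Fin 2) ℂ) = 1 := by
        ext i j; fin_cases i <;> fin_cases j <;> simp [Matrix.mul_apply]
      simp [apply_ite star, this, eq_comm])
    (by
      intro i j
      have : (!![0, 1; 1, 0] * star !![0, 1; 1, 0] : Matrix (Fin 2) (Fin 2) ℂ) = 1 := by
        ext i j; fin_cases i <;> fin_cases j <;> simp [Matrix.mul_apply]
      simp [apply_ite star, this]) 0

/-- The exchange matrix has zero diagonal but squares to `1`, so the first moments vanish while the
second moments of the `uᵢᵢ` equal `1`. -/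
theorem exchangeState_u (i j : Fin n) : (exchangeState n).toLin (u i j) = 0 := by
  simp [exchangeState, vectorState, lift_u]
  split_ifs <;> simp

theorem exchangeState_us_mul_u (i : Fin n) : (exchangeState n).toLin (us i i * u i i) = 1 := by
  simp [exchangeState, vectorState, lift_u, lift_us, Matrix.mul_apply]

/-! ### Nonexistence of Haar states -/

theorem coproduct_u_mul_us (i j k l : Fin n) :
    coproduct n (u i j * us k l) =
      ∑ p, ∑ q, leg 0 (u i p) * leg 1 (u p j * us q l) * leg 0 (us k q) := by
  rw [map_mul, coproduct_u, coproduct_us, Finset.sum_mul_sum]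
  simp only [map_mul, mul_assoc]

theorem coproduct_us_mul_u (i j k l : Fin n) :
    coproduct n (us i j * u k l) =
      ∑ p, ∑ q, leg 1 (us p j) * leg 0 (us i p * u k q) * leg 1 (u q l) := by
  rw [map_mul, coproduct_u, coproduct_us, Finset.sum_mul_sum]
  simp only [map_mul, mul_assoc]

/-- Convolution with `flipState m` on the right determines the second moments. -/
theorem convolution_flipState_right {c : Independence} {h : State (Unc n)} {m : Fin n}
    (hs : ∀ a b a', prodState c (counit n) h (flipState m) (leg 0 a * leg 1 b * leg 0 a') =
      h.toLin (a * a') * (flipState m).toLin b) (i : Fin n) :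
    convolution c h (flipState m) (u i i * us i i) = if i = m then 1 else 0 := by
  rw [convolution_apply, coproduct_u_mul_us]
  simp only [map_sum, hs, flipState_u_mul_us]
  -- For `i = m` the flip leaves `∑ₚ h(uᵢₚ uᵢₚ*)`, which is `h(1) = 1` by unitarity; for `i ≠ m`
  -- every term vanishes.
  have e := congrArg h.toLin (sum_u_mul_us i i)
  rw [if_pos rfl, h.map_one', map_sum] at e
  by_cases him : i = m
  · simp [him] at e ⊢
    exact e
  · simp [him]

/-- Convolution with `flipState m` on the left determines the second moments. -/
theorem convolution_flipState_left {c : Independence} {h : State (Unc n)} {m : Fin n}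
    (hs : ∀ b a b', prodState c (counit n) (flipState m) h (leg 1 b * leg 0 a * leg 1 b') =
      h.toLin (b * b') * (flipState m).toLin a) (i : Fin n) :
    convolution c (flipState m) h (us i i * u i i) = if i = m then 1 else 0 := by
  rw [convolution_apply, coproduct_us_mul_u]
  simp only [map_sum, hs, flipState_us_mul_u]
  have e := congrArg h.toLin (sum_us_mul_u i i)
  rw [if_pos rfl, h.map_one', map_sum] at e
  by_cases him : i = m
  · simp [him] at e ⊢
    exact e
  · simp [him]

/-- In `boolean_apply_sandwich` the products of first moments of `φ` vanish, and `δ(uᵢₚ* uᵢₖ)` is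
nonzero only for `p = k = i`. The state `h` thus drops out altogether. -/
theorem convolution_boolean (h φ : State (Unc n)) {i : Fin n} (hφ : ∀ p, φ.toLin (u p i) = 0) :
    convolution .boolean h φ (us i i * u i i) = φ.toLin (us i i * u i i) := by
  have hs := fun b a b' => (prodState_spec .boolean (counit n) h φ).boolean_apply_sandwich
    (prodState_weights h φ) (p := 0) (q := 1) (by simp) b a b'
  rw [convolution_apply, coproduct_us_mul_u]
  simp only [map_sum, hs]
  simp [hφ, counit_u, counit_us]

theorem not_isHaarState_of_right {c : Independence} {h : State (Unc n)} {i j : Fin n} (hij : i ≠ j)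
    (hs : ∀ m a b a', prodState c (counit n) h (flipState m) (leg 0 a * leg 1 b * leg 0 a') =
      h.toLin (a * a') * (flipState m).toLin b) : ¬ IsHaarState c h := by
  intro hh
  have h1 := convolution_flipState_right (hs i) i
  have h2 := convolution_flipState_right (hs j) i
  rw [(hh _).2] at h1 h2
  rw [h1] at h2
  simp [hij] at h2

theorem not_isHaarState_of_left {c : Independence} {h : State (Unc n)} {i j : Fin n} (hij : i ≠ j)
    (hs : ∀ m b a b', prodState c (counit n) (flipState m) h (leg 1 b * leg 0 a * leg 1 b') =
      h.toLin (b * b') * (flipState m).toLin a) : ¬ IsHaarState c h := by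
  intro hh
  have h1 := convolution_flipState_left (hs i) i
  have h2 := convolution_flipState_left (hs j) i
  rw [(hh _).1] at h1 h2
  rw [h1] at h2
  simp [hij] at h2

theorem not_isHaarState (c : Independence) (h : State (Unc n)) {i j : Fin n} (hij : i ≠ j) :
    ¬ IsHaarState c h := by
  cases c with
  | free =>
    exact not_isHaarState_of_right hij fun m =>
      (prodState_spec .free (counit n) h (flipState m)).free_apply_sandwich
        (prodState_weights _ _) (by simp)
  | tensor =>
    exact not_isHaarState_of_right hij fun m =>
      (prodState_spec .tensor (counit n) h (flipState m)).tensor_apply_sandwich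
        (prodState_weights _ _)
  | monotone =>
    exact not_isHaarState_of_right hij fun m =>
      ((prodState_spec .monotone (counit n) h (flipState m)).isMonotone
        (prodState_weights _ _)).apply_sandwich (prodState_weights _ _) (by simp)
  | antimonotone =>
    -- In the anti-monotone product it is the letters of the right leg that are multiplied together,
    -- so `h` has to stand on the right and the flip on the left.
    exact not_isHaarState_of_left hij fun m =>
      ((prodState_spec .antimonotone (counit n) (flipState m) h).isMonotone_swap
        (prodState_weights _ _)).apply_sandwich (prodState_weights _ _) (by simp)
  | boolean =>
    intro hh
    -- Both states vanish on the `i`-th column, but give `uᵢᵢ* uᵢᵢ` the values `0` and `1`.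
    have h1 := convolution_boolean h (flipState j) (i := i) (by simp [flipState_u, hij])
    have h2 := convolution_boolean h (exchangeState n) (i := i) (by simp [exchangeState_u])
    rw [(hh _).2] at h1 h2
    rw [h1, exchangeState_us_mul_u, flipState_us_mul_u] at h2
    simp [hij] at h2

end Unc

end UnitaryDual

theorem theorem2p1 :
    (∀ c : NCProb.Independence,
      UnitaryDual.Unc.IsHaarState c (UnitaryDual.Unc.circleState UnitaryDual.Unc.circleHaar) ∧
      ∀ h : NCProb.State (UnitaryDual.Unc 1), UnitaryDual.Unc.IsHaarState c h →
        h = UnitaryDual.Unc.circleState UnitaryDual.Unc.circleHaar) ∧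
    (∀ n : ℕ, 2 ≤ n → ∀ c : NCProb.Independence,
      ¬ ∃ h : NCProb.State (UnitaryDual.Unc n), UnitaryDual.Unc.IsHaarState c h) := by
  refine ⟨fun c => ⟨UnitaryDual.Unc.isHaarState_circleHaar c, fun h hh =>
    hh.eq (UnitaryDual.Unc.isHaarState_circleHaar c)⟩, ?_⟩
  rintro n hn c ⟨h, hh⟩
  exact UnitaryDual.Unc.not_isHaarState c h (i := ⟨0, by omega⟩) (j := ⟨1, by omega⟩)
    (by simp) hh
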